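/- Let $(M,g)$ be a smooth (Hausdorff, second countable) semi-Riemannian manifold of even dimension $d=q+p\ge 2$ and signature $(q,p)$ ($q$ minus signs, $p$ plus signs). Let $S\to M$ be a spinor bundle, i.e. a smooth complex vector bundle of finite rank together with a smooth family of algebra isomorphisms $\mathbb{C}\otimes\mathrm{Cl}(T_xM,g_x)\cong\mathrm{End}_{\mathbb C}(S_x)$, and write $\gamma(u)$ for the action of $u\in T_xM$ on $S_x$, so that $\gamma(u)\gamma(v)+\gamma(v)\gamma(u)=2g(u,v)$. A Robinson product is a smooth family $H=(H_x)$ of nondegenerate hermitian forms on the spaces $S_x$ with $H_x(\psi,\gamma(u)\varphi)=H_x(\gamma(u)\psi,\varphi)$ for all $u\in T_xM$. It defines the global product $(\psi,\varphi)_M=\int_M H_x(\psi,\varphi)\sqrt{|g|}\,d^dx$ on the space $\Gamma_c(M,S)$ of smooth compactly supported sections. Fix a splitting $TM=E_-\oplus E_+$ into orthogonal smooth subbundles on which $g$ is negative, respectively positive, definite. Let $\eta_x$ be the fundamental symmetry of $H_x$ of the form $\pm i^{q/2}\gamma(e_1)\cdots\gamma(e_q)$, with $(e_i)$ an orthonormal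 basis of $E_{-,x}$, if $q,p$ are even, and of the form $\pm i^{(p-1)/2}\gamma(f_1)\cdots\gamma(f_p)$, with $(f_i)$ an orthonormal basis of $E_{+,x}$, if $q,p$ are odd. Put $\langle\psi,\varphi\rangle_\eta=(\psi,\eta\varphi)_M$ and $\|\psi\|_\eta=\sqrt{\langle\psi,\psi\rangle_\eta}$; call $\|\cdot\|_\eta$ the norm on $\Gamma_c(M,S)$ induced by $H$ (and the splitting). The spinor Krein space of $H$ is the completion of $\Gamma_c(M,S)$ for $\langle\cdot,\cdot\rangle_\eta$, equipped with the extension of $(\cdot,\cdot)_M$. Let $H$ be a Robinson product. Then: 1. The fundamental symmetry $\eta$ exists, is unique and is smooth, and the spinor Krein space of $H$ exists. 2. Let $\lambda:M\to\mathbb{R}\setminus\{0\}$ be smooth. Then $H'=\lambda H$ is a Robinson product, and the norms on $\Gamma_c(M,S)$ induced by $H$ and by $H'$ (for the same splitting) are equivalent if and only if $\lambda$ is bounded with bounded inverse. 3. If $M$ is not compact, the spinor Krein space is not canonical: there is a smooth $\lambda:M\to\mathbb{R}\setminus\{0\}$ such that $H$ and the Robinson product $\lambda H$ induce inequivalent norms,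 and there is no isomorphism of topological vector spaces between the spinor Krein spaces of $H$ and of $\lambda H$ that restricts to the identity on $\Gamma_c(M,S)$. -/

import Mathlib

open scoped Manifold ContDiff Bundle TensorProduct ComplexConjugate
open Bundle MeasureTheory

noncomputable section

namespace SpinGeom

/-! ### Fundamental symmetries of indefinite hermitian forms -/

/-- `J` is a fundamental symmetry of the sesquilinear form `B` (antilinear in the first variable):
there is a decomposition `V = V₊ ⊕ V₋` into mutually `B`-orthogonal subspaces, with `B` positive
definite on `V₊` and negative definite on `V₋`, such that `J = 1` on `V₊` and `J = -1` on `V₋`. -/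
def IsFundamentalSymmetry {V : Type*} [AddCommGroup V] [Module ℂ V]
    (B : V →ₗ⋆[ℂ] V →ₗ[ℂ] ℂ) (J : V →ₗ[ℂ] V) : Prop :=
  ∃ Vp Vm : Submodule ℂ V, IsCompl Vp Vm ∧
    (∀ v ∈ Vp, v ≠ 0 → 0 < (B v v).re ∧ (B v v).im = 0) ∧
    (∀ v ∈ Vm, v ≠ 0 → (B v v).re < 0 ∧ (B v v).im = 0) ∧
    (∀ v ∈ Vp, ∀ w ∈ Vm, B v w = 0 ∧ B w v = 0) ∧
    (∀ v ∈ Vp, J v = v) ∧ (∀ v ∈ Vm, J v = -v)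

/-! ### Semi-Riemannian metrics, their splittings and their volume -/

/-- The tangent space of the `(q + p)`-dimensional manifold `M` at `x`. -/
abbrev TSp (q p : ℕ) {M : Type*} [TopologicalSpace M]
    [ChartedSpace (EuclideanSpace ℝ (Fin (q + p))) M] (x : M) : Type :=
  TangentSpace (𝓡 (q + p)) x

/-- The vector field `X` is smooth at `x₀`. -/
def SmoothFieldAt (q p : ℕ) {M : Type*} [TopologicalSpace M]
    [ChartedSpace (EuclideanSpace ℝ (Fin (q + p))) M] [IsManifold (𝓡 (q + p)) ∞ M]
    (X : ∀ x : M, TSp q p x) (x₀ : M) : Prop :=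
  ContMDiffAt (𝓡 (q + p)) (𝓡 (q + p)).tangent ∞
    (fun x ↦ (TotalSpace.mk' (EuclideanSpace ℝ (Fin (q + p))) x (X x) :
      TangentBundle (𝓡 (q + p)) M)) x₀

/-- A smooth metric of signature `(q, p)` on `TM`: `q` minus signs and `p` plus signs. -/
structure Metric (q p : ℕ) (M : Type*) [TopologicalSpace M]
    [ChartedSpace (EuclideanSpace ℝ (Fin (q + p))) M] [IsManifold (𝓡 (q + p)) ∞ M] where
  /-- The bilinear form on each tangent space. -/
  val (x : M) : TSp q p x →L[ℝ] TSp q p x →L[ℝ] ℝ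
  symm (x : M) (v w : TSp q p x) : val x v w = val x w v
  signature (x : M) : ∃ b : Module.Basis (Fin q ⊕ Fin p) ℝ (TSp q p x), ∀ i j,
    val x (b i) (b j) = if i = j then Sum.elim (fun _ ↦ -1) (fun _ ↦ 1) i else 0
  contMDiff : ContMDiff (𝓡 (q + p)) ((𝓡 (q + p)).prod
      𝓘(ℝ, EuclideanSpace ℝ (Fin (q + p)) →L[ℝ] EuclideanSpace ℝ (Fin (q + p)) →L[ℝ] ℝ)) ∞
    (fun x ↦ TotalSpace.mk'
      (EuclideanSpace ℝ (Fin (q + p)) →L[ℝ] EuclideanSpace ℝ (Fin (q + p)) →L[ℝ] ℝ) x (val x))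

section Manifold

variable {q p : ℕ} {M : Type*} [TopologicalSpace M]
  [ChartedSpace (EuclideanSpace ℝ (Fin (q + p))) M] [IsManifold (𝓡 (q + p)) ∞ M]

/-- The quadratic form `v ↦ g_x(v, v)` on `T_x M`. -/
def Metric.quad (g : Metric q p M) (x : M) : QuadraticForm ℝ (TSp q p x) :=
  (g.val x).toBilinForm.toQuadraticMap

/-- A family of subspaces `E_x ⊆ T_x M` is a smooth subbundle of rank `k`: it has smooth local
frames. -/
def IsSmoothSubbundle (k : ℕ) (E : ∀ x : M, Submodule ℝ (TSp q p x)) : Prop :=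
  ∀ x₀ : M, ∃ U : Set M, IsOpen U ∧ x₀ ∈ U ∧ ∃ X : Fin k → ∀ x : M, TSp q p x,
    (∀ i, ∀ x ∈ U, SmoothFieldAt q p (X i) x) ∧
    ∀ x ∈ U, LinearIndependent ℝ (fun i ↦ X i x) ∧
      Submodule.span ℝ (Set.range fun i ↦ X i x) = E x

/-- A splitting `TM = E₋ ⊕ E₊` into mutually orthogonal smooth subbundles, on which the metric is
negative definite and positive definite respectively. -/
structure Splitting (g : Metric q p M) where
  /-- The negative subbundle. -/
  neg (x : M) : Submodule ℝ (TSp q p x)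
  /-- The positive subbundle. -/
  pos (x : M) : Submodule ℝ (TSp q p x)
  isCompl (x : M) : IsCompl (neg x) (pos x)
  orthogonal (x : M) : ∀ v ∈ neg x, ∀ w ∈ pos x, g.val x v w = 0
  neg_def (x : M) : ∀ v ∈ neg x, v ≠ 0 → g.val x v v < 0
  pos_def (x : M) : ∀ v ∈ pos x, v ≠ 0 → 0 < g.val x v v
  smooth_neg : IsSmoothSubbundle q neg
  smooth_pos : IsSmoothSubbundle p pos

/-- The coordinate vector field `∂/∂yⁱ` of the chart at `c`, at the point with coordinates `y`. -/
def coordVector (c : M) (y : EuclideanSpace ℝ (Fin (q + p))) (i : Fin (q + p)) :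
    TSp q p ((chartAt (EuclideanSpace ℝ (Fin (q + p))) c).symm y) :=
  mfderiv (𝓡 (q + p)) (𝓡 (q + p)) (chartAt (EuclideanSpace ℝ (Fin (q + p))) c).symm y
    (EuclideanSpace.single i (1 : ℝ) : EuclideanSpace ℝ (Fin (q + p)))

/-- The density `√|det g_{ij}|` in the chart at `c`, as a function of the coordinates. -/
def Metric.density (g : Metric q p M) (c : M) (y : EuclideanSpace ℝ (Fin (q + p))) : ℝ :=
  √|(Matrix.of fun i j ↦ g.val _ (coordVector c y i) (coordVector c y j)).det|

/-- The measure `√|det g| dy¹ ⋯ dyᵈ` of the chart at `c`, carried by the domain of that chart. -/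
def Metric.chartVolume [MeasurableSpace M] (g : Metric q p M) (c : M) : Measure M :=
  ((volume.restrict (chartAt (EuclideanSpace ℝ (Fin (q + p))) c).target).withDensity
    fun y ↦ ENNReal.ofReal (g.density c y)).map
      (chartAt (EuclideanSpace ℝ (Fin (q + p))) c).symm

/-- The semi-Riemannian volume measure `√|g| dᵈx`. The measures of two charts agree on the overlap
of the charts, so that the measures of all charts are glued by taking their supremum. -/
def Metric.vol [MeasurableSpace M] (g : Metric q p M) : Measure M :=
  ⨆ c : M, g.chartVolume c

/-! ### Spinor bundles -/

section Spinors

variable {F : Type*} [NormedAddCommGroup F] [NormedSpace ℂ F]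
  {S : M → Type*} [TopologicalSpace (TotalSpace F S)]
  [∀ x, AddCommGroup (S x)] [∀ x, Module ℂ (S x)] [∀ x, TopologicalSpace (S x)]
  [FiberBundle F S] [VectorBundle ℂ F S] [VectorBundle ℝ F S]
  [ContMDiffVectorBundle ∞ F S (𝓡 (q + p))]

variable (q p F) in
/-- The section `ψ` of the complex vector bundle `S` is smooth at `x₀`. -/
def SmoothSectionAt (ψ : ∀ x : M, S x) (x₀ : M) : Prop :=
  ContMDiffAt (𝓡 (q + p)) ((𝓡 (q + p)).prod 𝓘(ℝ, F)) ∞ (fun x ↦ TotalSpace.mk' F x (ψ x)) x₀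

variable (q p F) in
/-- The field of endomorphisms `A` is smooth: it maps smooth local sections to smooth local
sections. -/
def SmoothEnd (A : ∀ x : M, S x →ₗ[ℂ] S x) : Prop :=
  ∀ (x₀ : M) (ψ : ∀ x : M, S x), SmoothSectionAt q p F ψ x₀ →
    SmoothSectionAt q p F (fun x ↦ A x (ψ x)) x₀

variable (q p F S) in
/-- The space `Γ_c(M, S)` of smooth spinors with compact support. -/
def CompactSpinors : Submodule ℂ (∀ x : M, S x) where
  carrier := {ψ | (∀ x₀, SmoothSectionAt q p F ψ x₀) ∧ IsCompact (closure {x | ψ x ≠ 0})}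
  add_mem' := by
    rintro ψ φ ⟨hψ, hψc⟩ ⟨hφ, hφc⟩
    refine ⟨fun x₀ ↦ ContMDiffAt.add_section (hψ x₀) (hφ x₀), ?_⟩
    refine (hψc.union hφc).of_isClosed_subset isClosed_closure ?_
    rw [← closure_union]
    refine closure_mono fun x hx ↦ ?_
    by_contra h
    simp only [Set.mem_union, Set.mem_ofPred_eq, not_or, not_not] at h
    exact hx (by simp [h.1, h.2])
  zero_mem' := by
    refine ⟨fun x₀ ↦ contMDiff_zeroSection ℝ S x₀, ?_⟩
    simp
  smul_mem' := by
    rintro c ψ ⟨hψ, hψc⟩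
    refine ⟨fun x₀ ↦ ?_, ?_⟩
    · have h := hψ x₀
      unfold SmoothSectionAt at h ⊢
      rw [contMDiffAt_section] at h ⊢
      have h2 : ContMDiffAt (𝓡 (q + p)) 𝓘(ℝ, F) ∞
          (fun x ↦ c • (trivializationAt F S x₀ (TotalSpace.mk' F x (ψ x))).2) x₀ := by
        have hc : ContMDiff 𝓘(ℝ, F) 𝓘(ℝ, F) ∞ (fun v : F ↦ c • v) :=
          (contDiff_const_smul c).contMDiff
        exact hc.contMDiffAt.comp x₀ h
      refine h2.congr_of_eventuallyEq ?_
      filter_upwards [(trivializationAt F S x₀).open_baseSet.mem_nhds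
        (FiberBundle.mem_baseSet_trivializationAt' x₀)] with x hx
      exact ((trivializationAt F S x₀).linear ℂ hx).map_smul c (ψ x)
    · refine hψc.of_isClosed_subset isClosed_closure (closure_mono fun x hx hx' ↦ hx ?_)
      simp [hx']

variable (F S) in
/-- A Clifford structure on `(M, g)` with spinor bundle `S`: a smooth identification of the bundle
of complexified Clifford algebras `ℂ ⊗ Cl(T_x M, g_x)` with the bundle of endomorphisms of `S`.
The relation in the Clifford algebra is `uv + vu = 2 g(u, v)`. -/
structure CliffordStructure (g : Metric q p M) where
  /-- The identification in the fibres over `x`. -/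
  rep (x : M) : (ℂ ⊗[ℝ] CliffordAlgebra (g.quad x)) ≃ₐ[ℂ] Module.End ℂ (S x)
  smooth (x₀ : M) (X : ∀ x : M, TSp q p x) (ψ : ∀ x : M, S x) :
    SmoothFieldAt q p X x₀ → SmoothSectionAt q p F ψ x₀ →
      SmoothSectionAt q p F
        (fun x ↦ rep x ((1 : ℂ) ⊗ₜ[ℝ] CliffordAlgebra.ι (g.quad x) (X x)) (ψ x)) x₀

variable {g : Metric q p M}

/-- Clifford multiplication `γ(u)` of spinors by the tangent vector `u`. -/
def CliffordStructure.gamma (cl : CliffordStructure F S g) (x : M) (u : TSp q p x) :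
    Module.End ℂ (S x) :=
  cl.rep x ((1 : ℂ) ⊗ₜ[ℝ] CliffordAlgebra.ι (g.quad x) u)

/-- `H` is a (local) Robinson product: a smooth family of nondegenerate hermitian forms on the
spinor spaces for which the `γ(u)`, `u ∈ T_x M`, are self-adjoint. -/
structure IsRobinsonProduct (cl : CliffordStructure F S g)
    (H : ∀ x : M, S x →ₗ⋆[ℂ] S x →ₗ[ℂ] ℂ) : Prop where
  hermitian (x : M) (ψ φ : S x) : conj (H x ψ φ) = H x φ ψ
  nondegenerate (x : M) (ψ : S x) : (∀ φ, H x ψ φ = 0) → ψ = 0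
  selfAdjoint (x : M) (u : TSp q p x) (ψ φ : S x) :
    H x ψ (cl.gamma x u φ) = H x (cl.gamma x u ψ) φ
  smooth (x₀ : M) (ψ φ : ∀ x : M, S x) :
    SmoothSectionAt q p F ψ x₀ → SmoothSectionAt q p F φ x₀ →
      ContMDiffAt (𝓡 (q + p)) 𝓘(ℝ, ℂ) ∞ (fun x ↦ H x (ψ x) (φ x)) x₀

/-- The family of forms `λ H`. -/
def scale (l : M → ℝ) (H : ∀ x : M, S x →ₗ⋆[ℂ] S x →ₗ[ℂ] ℂ) (x : M) :
    S x →ₗ⋆[ℂ] S x →ₗ[ℂ] ℂ :=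
  (l x : ℂ) • H x

/-- The field of endomorphisms `η` of the spinor bundle is the fundamental symmetry `η₊` of the
Robinson product `H` that is associated with the splitting `TM = E₋ ⊕ E₊`: at each point `x`, it is
a fundamental symmetry of `H_x`, and it has the form `± i^{q/2} γ(e₁) ⋯ γ(e_q)` for an orthonormal
basis `e` of `E₋` if `q` is even, and `± i^{(p-1)/2} γ(f₁) ⋯ γ(f_p)` for an orthonormal basis `f`
of `E₊` if `q` is odd (then `p` is odd too). -/
def IsSplittingSymmetry (cl : CliffordStructure F S g) (spl : Splitting g)
    (H : ∀ x : M, S x →ₗ⋆[ℂ] S x →ₗ[ℂ] ℂ) (η : ∀ x : M, S x →ₗ[ℂ] S x) : Prop :=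
  ∀ x : M, IsFundamentalSymmetry (H x) (η x) ∧ ∃ s : ℂ, (s = 1 ∨ s = -1) ∧
    if Even q then
      ∃ e : Fin q → TSp q p x, (∀ i, e i ∈ spl.neg x) ∧
        (∀ i j, g.val x (e i) (e j) = if i = j then -1 else 0) ∧
        η x = (s * Complex.I ^ (q / 2)) • (List.ofFn fun i ↦ cl.gamma x (e i)).prod
    else
      ∃ f : Fin p → TSp q p x, (∀ i, f i ∈ spl.pos x) ∧
        (∀ i j, g.val x (f i) (f j) = if i = j then 1 else 0) ∧
        η x = (s * Complex.I ^ ((p - 1) / 2)) • (List.ofFn fun i ↦ cl.gamma x (f i)).prod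

open Classical in
/-- The fundamental symmetry `η₊` of `H` associated with the splitting (it is unique). -/
def splittingSymmetry (cl : CliffordStructure F S g) (spl : Splitting g)
    (H : ∀ x : M, S x →ₗ⋆[ℂ] S x →ₗ[ℂ] ℂ) : ∀ x : M, S x →ₗ[ℂ] S x :=
  if h : ∃ η, IsSplittingSymmetry cl spl H η then h.choose else 0

/-! ### Products and norms on compactly supported spinors -/

variable [MeasurableSpace M]

variable (g) in
/-- The global product `(ψ, φ)_M = ∫_M H_x(ψ, φ) √|g| dᵈx`. -/
def globalProduct (H : ∀ x : M, S x →ₗ⋆[ℂ] S x →ₗ[ℂ] ℂ) (ψ φ : ∀ x : M, S x) : ℂ :=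
  ∫ x, H x (ψ x) (φ x) ∂g.vol

/-- The inner product `⟨ψ, φ⟩_η = (ψ, η φ)_M` that the Robinson product `H` and the splitting
induce on compactly supported spinors. -/
def hilbertProduct (cl : CliffordStructure F S g) (spl : Splitting g)
    (H : ∀ x : M, S x →ₗ⋆[ℂ] S x →ₗ[ℂ] ℂ) (ψ φ : CompactSpinors q p F S) : ℂ :=
  globalProduct g H ψ.1 fun x ↦ splittingSymmetry cl spl H x (φ.1 x)

/-- The norm `‖ψ‖_η = √⟨ψ, ψ⟩_η`. -/
def hilbertNorm (cl : CliffordStructure F S g) (spl : Splitting g)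
    (H : ∀ x : M, S x →ₗ⋆[ℂ] S x →ₗ[ℂ] ℂ) (ψ : CompactSpinors q p F S) : ℝ :=
  √(hilbertProduct cl spl H ψ ψ).re

/-- `(K, B)`, together with the map `ι` from the compactly supported spinors to `K`, is the spinor
Krein space given by the Robinson product `H` and the splitting: the Hilbert space `K` is the
completion of the compactly supported spinors for `⟨·, ·⟩_η`, the form `B` on `K` extends the global
product `(·, ·)_M`, and the inner product of `K` is `B(·, J ·)` for some fundamental symmetry `J`
of `B`. -/
structure IsSpinorKreinSpace (cl : CliffordStructure F S g) (spl : Splitting g)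
    (H : ∀ x : M, S x →ₗ⋆[ℂ] S x →ₗ[ℂ] ℂ)
    {K : Type*} [NormedAddCommGroup K] [InnerProductSpace ℂ K] [CompleteSpace K]
    (ι : CompactSpinors q p F S →ₗ[ℂ] K) (B : K →ₗ⋆[ℂ] K →ₗ[ℂ] ℂ) : Prop where
  denseRange : DenseRange ι
  inner_eq (ψ φ : CompactSpinors q p F S) :
    inner ℂ (ι ψ) (ι φ) = hilbertProduct cl spl H ψ φ
  form_eq (ψ φ : CompactSpinors q p F S) : B (ι ψ) (ι φ) = globalProduct g H ψ.1 φ.1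
  krein : ∃ J : K →ₗ[ℂ] K, IsFundamentalSymmetry B J ∧ ∀ v w, inner ℂ v w = B v (J w)

end Spinors

end Manifold

/-- The norms `N` and `N'` on `V` are equivalent. -/
def NormsEquivalent {V : Type*} (N N' : V → ℝ) : Prop :=
  ∃ a b : ℝ, 0 < a ∧ 0 < b ∧ ∀ v, a * N v ≤ N' v ∧ N' v ≤ b * N v

/-- The nowhere vanishing function `l` is bounded with bounded inverse. -/
def BoundedWithBoundedInverse {M : Type*} (l : M → ℝ) : Prop :=
  (∃ C : ℝ, ∀ x, |l x| ≤ C) ∧ ∃ C : ℝ, ∀ x, |(l x)⁻¹| ≤ C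

end SpinGeom

end

universe u v w₀ w₁ w₂

/-!
The proof separates the pointwise algebra of the fundamental symmetry from the analysis of the
global product.

*Algebra.* Let `Γ = i^{⌊n/2⌋} γ(e₁) ⋯ γ(eₙ)` for an orthonormal basis of `E₋` (if `q` is even) or of
`E₊` (if `q` is odd). Then `Γ` is an `H_x`-self-adjoint involution that commutes with `γ(u)` for
`u ∈ E₊` and anticommutes with `γ(u)` for `u ∈ E₋`. Consequently the form `H_x(·, Γ ·)` is invariant
under Clifford multiplication by the unit vectors of `E₋` and `E₊`. So is some positive definite
form, by averaging, and the two are proportional by Schur's lemma, since only scalars commute with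
all `γ(u)`. Hence `H_x(·, Γ ·)` is definite, and `Γ` or `-Γ` is a fundamental symmetry
(`exists_isAdapted_smul_volumeOperator`). The commutation relations characterise it without
reference to a frame (`IsAdapted`, `isSplittingSymmetry_iff`): two such involutions differ by a
scalar, which is `±1`, and positivity fixes the sign (`IsAdapted.unique`). Smoothness follows by
using smooth orthonormal frames from the Gram–Schmidt process, the sign being locally constant
(`smoothEnd_splittingSymmetry`).

*Analysis.* By the change of variables formula, the measures `√|det g| dy` of the charts agree on
overlaps, so that their supremum is finite on compact sets and positive on nonempty open sets
(`Metric.vol_apply`). Compactly supported spinors therefore have integrable products, and `η`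
acts on them as an isometric involution, which extends to the completion; this gives the Krein space
(`exists_spinorKreinSpace`). The symmetry of `λ H` is `sign(λ) η`, so that the squared norm of `λ H`
is the integral of `|λ| H_x(ψ, η ψ)`. Testing with spinors supported near a point shows that
estimates between the norms are pointwise estimates of `|λ|` (`nonneg_of_integral_nonneg`,
`normsEquivalent_scale_iff`). On a noncompact manifold there is a positive smooth function that is
unbounded (`exists_smooth_pos_unbounded`), and an isomorphism of the Krein spaces over the identity
of the compactly supported spinors would make the norms equivalent.
-/

namespace SpinGeom

set_option linter.unusedSectionVars false

/-! ### Products of anticommuting elements -/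

section Anticommuting

variable {A : Type*} [Ring A]

lemma mul_prod_of_anticommute {a : A} {l : List A} (h : ∀ b ∈ l, a * b = -(b * a)) :
    a * l.prod = (-1) ^ l.length * (l.prod * a) := by
  induction l with
  | nil => simp
  | cons b t ih =>
    have ht := ih fun c hc ↦ h c (List.mem_cons_of_mem _ hc)
    have hc : Commute ((-1 : A) ^ t.length) b := (Commute.neg_one_left b).pow_left _
    rw [List.prod_cons, ← mul_assoc, h b List.mem_cons_self, neg_mul, mul_assoc, ht,
      ← mul_assoc b, ← hc.eq, List.length_cons, pow_succ]
    simp [mul_assoc]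

lemma mul_prod_of_mem {a : A} {l : List A} (hl : l.Pairwise fun b c ↦ b * c = -(c * b))
    (ha : a ∈ l) : a * l.prod = (-1) ^ (l.length + 1) * (l.prod * a) := by
  induction l with
  | nil => simp at ha
  | cons b t ih =>
    obtain ⟨hb, ht⟩ := List.pairwise_cons.1 hl
    have hc : Commute ((-1 : A) ^ t.length) b := (Commute.neg_one_left b).pow_left _
    rcases List.mem_cons.1 ha with rfl | ha
    · have h := mul_prod_of_anticommute hb
      calc a * (a :: t).prod = a * ((-1) ^ t.length * (t.prod * a)) := by rw [List.prod_cons, h]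
        _ = (-1) ^ t.length * ((a * t.prod) * a) := by
          rw [← mul_assoc, ← hc.eq, mul_assoc, mul_assoc]
        _ = _ := by simp [pow_succ]
    · have hab : a * b = -(b * a) := by rw [hb a ha, neg_neg]
      rw [List.prod_cons, ← mul_assoc, hab, neg_mul, mul_assoc, ih ht ha, List.length_cons,
        pow_succ _ (t.length + 1), pow_succ, ← mul_assoc b]
      simp only [mul_neg, mul_one, neg_mul, neg_neg]
      rw [← hc.eq]
      simp [mul_assoc]

lemma prod_reverse_of_anticommute {l : List A} (hl : l.Pairwise fun b c ↦ b * c = -(c * b)) :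
    l.reverse.prod = (-1) ^ l.length.choose 2 * l.prod := by
  induction l with
  | nil => simp
  | cons b t ih =>
    obtain ⟨hb, ht⟩ := List.pairwise_cons.1 hl
    have h := mul_prod_of_anticommute hb
    rw [List.reverse_cons, List.prod_append, ih ht, List.prod_cons (l := t), h, List.length_cons,
      Nat.choose_succ_succ' t.length 1, Nat.choose_one_right, List.prod_singleton, pow_add]
    have : (-1 : A) ^ t.length * (-1) ^ t.length = 1 := by rw [← pow_add, Even.neg_one_pow ⟨_, rfl⟩]
    have hc : Commute ((-1 : A) ^ t.length) ((-1) ^ t.length.choose 2) :=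
      Commute.pow_pow_self _ _ _
    rw [hc.eq, mul_assoc, mul_assoc ((-1) ^ t.length.choose 2), ← mul_assoc ((-1) ^ t.length), this,
      one_mul]

lemma prod_mul_prod_reverse {l : List A} {c : A} (hc : ∀ a : A, Commute c a)
    (hl : ∀ b ∈ l, b * b = c) : l.prod * l.reverse.prod = c ^ l.length := by
  induction l with
  | nil => simp
  | cons b t ih =>
    rw [List.reverse_cons, List.prod_append, List.prod_cons, List.prod_singleton, List.length_cons,
      mul_assoc, ← mul_assoc t.prod, ih fun d hd ↦ hl d (List.mem_cons_of_mem _ hd),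
      ((hc b).pow_left _).eq, ← mul_assoc, hl b List.mem_cons_self, pow_succ']

end Anticommuting

/-- The sign `(-1) ^ (n choose 2)` of the reversal of `n` anticommuting factors. -/
lemma neg_one_pow_choose_two (n : ℕ) {R : Type*} [Ring R] :
    (-1 : R) ^ n.choose 2 = (-1) ^ (n / 2) := by
  obtain ⟨k, rfl | rfl⟩ := n.even_or_odd'
  · rcases k with _ | k
    · simp
    · rw [Nat.choose_two_right, show 2 * (k + 1) * (2 * (k + 1) - 1) / 2 = (k + 1) * (2 * k + 1) by
        rw [show 2 * (k + 1) * (2 * (k + 1) - 1) = 2 * ((k + 1) * (2 * k + 1)) by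
          rw [show 2 * (k + 1) - 1 = 2 * k + 1 by omega]; ring]
        omega, show 2 * (k + 1) / 2 = k + 1 by omega, mul_comm (k + 1), pow_mul,
        Odd.neg_one_pow ⟨k, rfl⟩]
  · rw [Nat.choose_two_right, show (2 * k + 1) * (2 * k + 1 - 1) / 2 = (2 * k + 1) * k by
        rw [show (2 * k + 1) * (2 * k + 1 - 1) = 2 * ((2 * k + 1) * k) by
          rw [show 2 * k + 1 - 1 = 2 * k by omega]; ring]
        omega, show (2 * k + 1) / 2 = k by omega, pow_mul,
        Odd.neg_one_pow ⟨k, rfl⟩]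

/-! ### Definiteness of invariant hermitian forms -/

section Forms

variable {V : Type*} [AddCommGroup V] [Module ℂ V]

/-- The sesquilinear form `B` is hermitian and positive definite. -/
structure IsPosDefForm (B : V →ₗ⋆[ℂ] V →ₗ[ℂ] ℂ) : Prop where
  hermitian (v w : V) : conj (B v w) = B w v
  pos (v : V) : v ≠ 0 → 0 < (B v v).re

/-- Averaging makes a positive definite form invariant under any finite family of operators that
square to `±1` and pairwise commute or anticommute: each single average `h + h(a ·, a ·)` keeps the
invariance that has been reached before. -/
lemma exists_invariant_isPosDefForm [FiniteDimensional ℂ V] (l : List (Module.End ℂ V))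
    (hsq : ∀ a ∈ l, a * a = 1 ∨ a * a = -1)
    (hcomm : ∀ a ∈ l, ∀ b ∈ l, a * b = b * a ∨ a * b = -(b * a)) :
    ∃ h : V →ₗ⋆[ℂ] V →ₗ[ℂ] ℂ, IsPosDefForm h ∧ ∀ a ∈ l, ∀ v w, h (a v) (a w) = h v w := by
  induction l with
  | nil =>
    let b := Module.finBasis ℂ V
    let e : V ≃ₗ[ℂ] EuclideanSpace ℂ (Fin (Module.finrank ℂ V)) :=
      b.equivFun.trans (WithLp.linearEquiv 2 ℂ _).symm
    let B := innerₛₗ ℂ (E := EuclideanSpace ℂ (Fin (Module.finrank ℂ V)))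
    refine ⟨(B.comp e.toLinearMap).compl₂ e.toLinearMap, ⟨fun v w ↦ ?_, fun v hv ↦ ?_⟩, by simp⟩
    · exact inner_conj_symm (𝕜 := ℂ) (e w) (e v)
    · have : e v ≠ 0 := by simpa using hv
      have h2 := (inner_self_eq_norm_sq (𝕜 := ℂ) (e v))
      have h3 : 0 < ‖e v‖ ^ 2 := by positivity
      rw [← h2] at h3
      exact h3
  | cons a t ih =>
    obtain ⟨h, hpos, hinv⟩ := ih (fun b hb ↦ hsq b (List.mem_cons_of_mem _ hb))
      fun b hb c hc ↦ hcomm b (List.mem_cons_of_mem _ hb) c (List.mem_cons_of_mem _ hc)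
    refine ⟨h + (h.comp a).compl₂ a, ⟨fun v w ↦ ?_, fun v hv ↦ ?_⟩, fun b hb v w ↦ ?_⟩
    · simp [hpos.hermitian]
    · have h1 := hpos.pos v hv
      have h2 : 0 ≤ (h (a v) (a v)).re := by
        by_cases h0 : a v = 0
        · simp [h0]
        · exact (hpos.pos _ h0).le
      simpa using add_pos_of_pos_of_nonneg h1 h2
    · simp only [LinearMap.add_apply, LinearMap.compl₂_apply, LinearMap.comp_apply]
      rcases List.mem_cons.1 hb with rfl | hb'
      · rw [add_comm]
        congr 1
        rcases hsq b hb with h1 | h1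
        · have h2 (v : V) : b (b v) = v := by simpa using LinearMap.congr_fun h1 v
          rw [h2, h2]
        · have h2 (v : V) : b (b v) = -v := by simpa using LinearMap.congr_fun h1 v
          rw [h2, h2]
          simp
      · rw [hinv b hb']
        congr 1
        rcases hcomm a List.mem_cons_self b hb with h1 | h1
        · have h2 (v : V) : a (b v) = b (a v) := by simpa using LinearMap.congr_fun h1 v
          rw [h2, h2, hinv b hb']
        · have h2 (v : V) : a (b v) = -(b (a v)) := by simpa using LinearMap.congr_fun h1 v
          rw [h2, h2]
          simp [hinv b hb']

/-- A sesquilinear form is represented by an operator with respect to a positive definite one. -/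
lemma IsPosDefForm.exists_representation [FiniteDimensional ℂ V] {h : V →ₗ⋆[ℂ] V →ₗ[ℂ] ℂ}
    (hpos : IsPosDefForm h) (B : V →ₗ⋆[ℂ] V →ₗ[ℂ] ℂ) :
    ∃ a : Module.End ℂ V, ∀ v w, B v w = h (a v) w := by
  let core : InnerProductSpace.Core ℂ V :=
    { inner := fun v w ↦ h v w
      conj_inner_symm := fun v w ↦ hpos.hermitian w v
      re_inner_nonneg := fun v ↦ by
        by_cases h0 : v = 0
        · simp [h0]
        · exact (hpos.pos v h0).le
      add_left := fun u v w ↦ by simp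
      smul_left := fun u v c ↦ by simp
      definite := fun v hv ↦ by
        by_contra h0
        have := hpos.pos v h0
        rw [hv] at this
        simp at this }
  let _ : NormedAddCommGroup V := core.toNormedAddCommGroup
  let _ : InnerProductSpace ℂ V := InnerProductSpace.ofCore core.toCore
  have _ : CompleteSpace V := FiniteDimensional.complete ℂ V
  have key (v w : V) :
      h ((InnerProductSpace.toDual ℂ V).symm (LinearMap.toContinuousLinearMap (B v))) w = B v w :=
    InnerProductSpace.toDual_symm_apply (𝕜 := ℂ) (E := V)
  refine ⟨{ toFun := fun v ↦
              (InnerProductSpace.toDual ℂ V).symm (LinearMap.toContinuousLinearMap (B v))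
            map_add' := fun v w ↦ by simp
            map_smul' := fun c v ↦ by simp [LinearIsometryEquiv.map_smulₛₗ] }, fun v w ↦ (key v w).symm⟩

/-- A nondegenerate hermitian form that is invariant under an irreducible family of operators (in
the sense that only the scalars commute with it), which preserves a positive definite form, is
definite: by Schur's lemma it is a real multiple of that positive definite form. -/
lemma definite_of_invariant [FiniteDimensional ℂ V] [Nontrivial V] {s : Set (Module.End ℂ V)}
    (hschur : ∀ a : Module.End ℂ V, (∀ b ∈ s, a * b = b * a) → ∃ c : ℂ, a = c • 1)
    (hunit : ∀ b ∈ s, Function.Surjective b)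
    {h B : V →ₗ⋆[ℂ] V →ₗ[ℂ] ℂ} (hpos : IsPosDefForm h)
    (hinv : ∀ b ∈ s, ∀ v w, h (b v) (b w) = h v w)
    (hB : ∀ v w, conj (B v w) = B w v) (hnd : ∀ v, (∀ w, B v w = 0) → v = 0)
    (hBinv : ∀ b ∈ s, ∀ v w, B (b v) (b w) = B v w) :
    ∃ ε : ℝ, (ε = 1 ∨ ε = -1) ∧ ∀ v, v ≠ 0 → 0 < ε * (B v v).re := by
  have hdef (v : V) (hv : ∀ w, h v w = 0) : v = 0 := by
    by_contra h0
    have := hpos.pos v h0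
    simp [hv] at this
  obtain ⟨a, ha⟩ := hpos.exists_representation B
  obtain ⟨c, hc⟩ := hschur a fun b hb ↦ by
    ext v
    rw [← sub_eq_zero]
    refine hdef _ fun w ↦ ?_
    obtain ⟨w, rfl⟩ := hunit b hb w
    simp [← ha, hBinv b hb, hinv b hb]
  have hBc (v : V) : B v v = conj c * h v v := by rw [ha, hc]; simp
  have him (v : V) : (h v v).im = 0 := Complex.conj_eq_iff_im.1 (hpos.hermitian v v)
  have hre (v : V) : (B v v).re = c.re * (h v v).re := by simp [hBc, him]
  -- `c` is real, as both forms are real on the diagonal, and not zero, as `B` is nondegenerate.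
  have hc0 : c.re ≠ 0 := by
    intro h0
    obtain ⟨v, hv⟩ := exists_ne (0 : V)
    have him' : (B v v).im = 0 := Complex.conj_eq_iff_im.1 (hB v v)
    have hp := hpos.pos v hv
    have : c.im = 0 := by
      have h2 : (B v v).im = -c.im * (h v v).re := by simp [hBc, him]
      rw [him'] at h2
      simpa [hp.ne'] using h2.symm
    have hc' : c = 0 := Complex.ext h0 this
    exact hv (hnd v fun w ↦ by simp [ha, hc, hc'])
  rcases hc0.lt_or_gt with h0 | h0
  · refine ⟨-1, Or.inr rfl, fun v hv ↦ ?_⟩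
    rw [hre]
    have := hpos.pos v hv
    nlinarith
  · refine ⟨1, Or.inl rfl, fun v hv ↦ ?_⟩
    rw [hre, one_mul]
    exact mul_pos h0 (hpos.pos v hv)

/-! ### Fundamental symmetries -/

lemma IsFundamentalSymmetry.mul_self {B : V →ₗ⋆[ℂ] V →ₗ[ℂ] ℂ} {J : Module.End ℂ V}
    (h : IsFundamentalSymmetry B J) : J * J = 1 := by
  obtain ⟨Vp, Vm, hc, -, -, -, hp, hm⟩ := h
  ext v
  obtain ⟨a, ha, b, hb, rfl⟩ := Submodule.mem_sup.1 (hc.sup_eq_top ▸ Submodule.mem_top (x := v))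
  simp [hp a ha, hm b hb]

lemma IsFundamentalSymmetry.pos {B : V →ₗ⋆[ℂ] V →ₗ[ℂ] ℂ} {J : Module.End ℂ V}
    (h : IsFundamentalSymmetry B J) {v : V} (hv : v ≠ 0) : 0 < (B v (J v)).re := by
  obtain ⟨Vp, Vm, hc, hBp, hBm, ho, hp, hm⟩ := h
  obtain ⟨a, ha, b, hb, rfl⟩ := Submodule.mem_sup.1 (hc.sup_eq_top ▸ Submodule.mem_top (x := v))
  have key : (B (a + b) (J (a + b))).re = (B a a).re - (B b b).re := by
    simp [hp a ha, hm b hb, (ho a ha b hb).1, (ho a ha b hb).2, sub_eq_add_neg]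
  rw [key]
  have h1 : 0 ≤ (B a a).re := by
    by_cases h0 : a = 0
    · simp [h0]
    · exact (hBp a ha h0).1.le
  have h2 : (B b b).re ≤ 0 := by
    by_cases h0 : b = 0
    · simp [h0]
    · exact (hBm b hb h0).1.le
  by_cases h0 : a = 0
  · have : b ≠ 0 := by rintro rfl; simp [h0] at hv
    linarith [(hBm b hb this).1]
  · linarith [(hBp a ha h0).1]

lemma IsFundamentalSymmetry.symm_apply {B : V →ₗ⋆[ℂ] V →ₗ[ℂ] ℂ} {J : Module.End ℂ V}
    (h : IsFundamentalSymmetry B J) (v w : V) : B v (J w) = B (J v) w := by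
  obtain ⟨Vp, Vm, hc, -, -, ho, hp, hm⟩ := h
  obtain ⟨a, ha, b, hb, rfl⟩ := Submodule.mem_sup.1 (hc.sup_eq_top ▸ Submodule.mem_top (x := v))
  obtain ⟨c, hc', d, hd, rfl⟩ := Submodule.mem_sup.1 (hc.sup_eq_top ▸ Submodule.mem_top (x := w))
  simp [hp a ha, hm b hb, hp c hc', hm d hd, (ho a ha d hd).1, (ho c hc' b hb).2]

lemma isFundamentalSymmetry_of_involution {B : V →ₗ⋆[ℂ] V →ₗ[ℂ] ℂ} {J : Module.End ℂ V}
    (hB : ∀ v w, conj (B v w) = B w v) (hJ : J * J = 1) (hsa : ∀ v w, B v (J w) = B (J v) w)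
    (hpos : ∀ v, v ≠ 0 → 0 < (B v (J v)).re) : IsFundamentalSymmetry B J := by
  have hJJ (v : V) : J (J v) = v := by simpa using LinearMap.congr_fun hJ v
  have him (v : V) : (B v v).im = 0 := Complex.conj_eq_iff_im.1 (hB v v)
  have hortho (v w : V) (hv : J v = v) (hw : J w = -w) : B v w = 0 := by
    have h := hsa v w
    rw [hv, hw, map_neg] at h
    exact self_eq_neg.1 h.symm
  have hp (v : V) : v ∈ LinearMap.ker (J - 1) ↔ J v = v := by
    simp [sub_eq_zero]
  have hm (v : V) : v ∈ LinearMap.ker (J + 1) ↔ J v = -v := by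
    simp [add_eq_zero_iff_eq_neg]
  have hcompl : IsCompl (LinearMap.ker (J - 1)) (LinearMap.ker (J + 1)) := by
    constructor
    · rw [Submodule.disjoint_def]
      intro v hv hw
      have h : (2 : ℂ) • v = 0 := by
        rw [two_smul]
        exact add_eq_zero_iff_eq_neg.2 (((hp v).1 hv).symm.trans ((hm v).1 hw))
      simpa using h
    · rw [codisjoint_iff, eq_top_iff]
      intro v _
      refine Submodule.mem_sup.2 ⟨(1 / 2 : ℂ) • (v + J v), (hp _).2 ?_, (1 / 2 : ℂ) • (v - J v),
        (hm _).2 ?_, ?_⟩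
      · simp only [map_smul, map_add, hJJ]; module
      · simp only [map_smul, map_sub, hJJ]; module
      · module
  refine ⟨_, _, hcompl, fun v hv h0 ↦ ?_, fun v hv h0 ↦ ?_, fun v hv w hw ↦ ?_,
    fun v hv ↦ (hp v).1 hv, fun v hv ↦ (hm v).1 hv⟩
  · have := hpos v h0
    rw [(hp v).1 hv] at this
    exact ⟨this, him v⟩
  · have := hpos v h0
    rw [(hm v).1 hv] at this
    exact ⟨by simpa using this, him v⟩
  · have h := hortho v w ((hp v).1 hv) ((hm w).1 hw)
    exact ⟨h, by rw [← hB, h, map_zero]⟩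

end Forms

/-! ### Clifford multiplication in a fibre -/

section Fibre

variable {q p : ℕ} {M : Type*} [TopologicalSpace M]
  [ChartedSpace (EuclideanSpace ℝ (Fin (q + p))) M] [IsManifold (𝓡 (q + p)) ∞ M]
  {F : Type*} [NormedAddCommGroup F] [NormedSpace ℂ F]
  {S : M → Type*} [TopologicalSpace (TotalSpace F S)]
  [∀ x, AddCommGroup (S x)] [∀ x, Module ℂ (S x)] [∀ x, TopologicalSpace (S x)]
  [FiberBundle F S] [VectorBundle ℂ F S] [VectorBundle ℝ F S]
  [ContMDiffVectorBundle ∞ F S (𝓡 (q + p))]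
  {g : Metric q p M}

variable (F) in
lemma finiteDimensional_fibre [FiniteDimensional ℂ F] (x : M) : FiniteDimensional ℂ (S x) :=
  ((trivializationAt F S x).linearEquivAt ℂ x
    (FiberBundle.mem_baseSet_trivializationAt' x)).symm.finiteDimensional

namespace CliffordStructure

variable (cl : CliffordStructure F S g) (x : M)

lemma nontrivial_fibre (cl : CliffordStructure F S g) (x : M) : Nontrivial (S x) := by
  by_contra h
  rw [not_nontrivial_iff_subsingleton] at h
  have h1 : (1 : ℂ ⊗[ℝ] CliffordAlgebra (g.quad x)) = 0 :=
    (cl.rep x).injective (by ext v; exact Subsingleton.elim _ _)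
  exact one_ne_zero h1

lemma gamma_add (u v : TSp q p x) : cl.gamma x (u + v) = cl.gamma x u + cl.gamma x v := by
  simp [gamma, TensorProduct.tmul_add]

lemma gamma_smul (r : ℝ) (u : TSp q p x) : cl.gamma x (r • u) = (r : ℂ) • cl.gamma x u := by
  rw [gamma, gamma, ← map_smul, map_smul, TensorProduct.tmul_smul, TensorProduct.smul_tmul',
    TensorProduct.smul_tmul']
  simp

lemma gamma_zero : cl.gamma x 0 = 0 := by
  simp [gamma]

lemma gamma_mul_self (u : TSp q p x) :
    cl.gamma x u * cl.gamma x u = ((g.val x u u : ℝ) : ℂ) • 1 := by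
  rw [gamma, ← map_mul, Algebra.TensorProduct.tmul_mul_tmul, CliffordAlgebra.ι_sq_scalar, mul_one,
    Algebra.algebraMap_eq_smul_one, TensorProduct.tmul_smul, TensorProduct.smul_tmul',
    ← Complex.coe_smul, ← TensorProduct.smul_tmul', map_smul, ← Algebra.TensorProduct.one_def,
    map_one]
  rfl

lemma gamma_mul_gamma_add (u v : TSp q p x) :
    cl.gamma x u * cl.gamma x v + cl.gamma x v * cl.gamma x u =
      ((2 * g.val x u v : ℝ) : ℂ) • 1 := by
  have h := cl.gamma_mul_self x (u + v)
  have hg : g.val x (u + v) (u + v) = g.val x u u + g.val x v v + 2 * g.val x u v := by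
    simp only [map_add, add_apply, g.symm x v u]
    ring
  rw [hg, cl.gamma_add, Complex.ofReal_add, Complex.ofReal_add, add_smul, add_smul,
    ← cl.gamma_mul_self, ← cl.gamma_mul_self] at h
  rw [← add_right_inj (cl.gamma x u * cl.gamma x u + cl.gamma x v * cl.gamma x v), ← h]
  noncomm_ring

lemma gamma_anticommute {u v : TSp q p x} (h : g.val x u v = 0) :
    cl.gamma x u * cl.gamma x v = -(cl.gamma x v * cl.gamma x u) := by
  rw [← add_eq_zero_iff_eq_neg, gamma_mul_gamma_add, h]
  simp

/-- Schur's lemma for the spinor representation: it is irreducible because it identifies the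
complexified Clifford algebra with the full endomorphism algebra, which is central. -/
lemma eq_smul_one_of_commute [FiniteDimensional ℂ F] {a : Module.End ℂ (S x)}
    (h : ∀ u, a * cl.gamma x u = cl.gamma x u * a) : ∃ c : ℂ, a = c • 1 := by
  have h1 (z : CliffordAlgebra (g.quad x)) :
      Commute a (cl.rep x ((1 : ℂ) ⊗ₜ[ℝ] z)) := by
    induction z using CliffordAlgebra.induction with
    | algebraMap r =>
      rw [Algebra.algebraMap_eq_smul_one, TensorProduct.tmul_smul, TensorProduct.smul_tmul',
        ← Complex.coe_smul, ← TensorProduct.smul_tmul', map_smul, ← Algebra.TensorProduct.one_def,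
        map_one]
      exact (Commute.one_right a).smul_right _
    | ι u => exact h u
    | mul y z hy hz =>
      rw [← mul_one (1 : ℂ), ← Algebra.TensorProduct.tmul_mul_tmul, map_mul]
      exact hy.mul_right hz
    | add y z hy hz =>
      rw [TensorProduct.tmul_add, map_add]
      exact hy.add_right hz
  have h2 (z : ℂ ⊗[ℝ] CliffordAlgebra (g.quad x)) : Commute a (cl.rep x z) := by
    induction z using TensorProduct.induction_on with
    | zero => simp
    | tmul c z =>
      rw [← mul_one c, ← smul_eq_mul, ← TensorProduct.smul_tmul', map_smul]
      exact (h1 z).smul_right _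
    | add y z hy hz =>
      rw [map_add]
      exact hy.add_right hz
  have hc : a ∈ Subalgebra.center ℂ (Module.End ℂ (S x)) := by
    rw [Subalgebra.mem_center_iff]
    intro b
    obtain ⟨z, rfl⟩ := (cl.rep x).surjective b
    exact (h2 z).eq.symm
  rw [Algebra.IsCentral.center_eq_bot, Algebra.mem_bot] at hc
  obtain ⟨c, rfl⟩ := hc
  exact ⟨c, Algebra.algebraMap_eq_smul_one c⟩

/-- The operator `i^{⌊n/2⌋} γ(e₁) ⋯ γ(eₙ)` of a family of `n` tangent vectors. -/
noncomputable def volumeOperator {n : ℕ} (e : Fin n → TSp q p x) : Module.End ℂ (S x) :=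
  Complex.I ^ (n / 2) • (List.ofFn fun i ↦ cl.gamma x (e i)).prod

variable {x} {n : ℕ} {e : Fin n → TSp q p x} {ε : ℝ}

lemma pairwise_anticommute (he : ∀ i j, g.val x (e i) (e j) = if i = j then ε else 0) :
    (List.ofFn fun i ↦ cl.gamma x (e i)).Pairwise fun b c ↦ b * c = -(c * b) := by
  rw [List.pairwise_ofFn]
  exact fun i j hij ↦ cl.gamma_anticommute x (by rw [he, if_neg hij.ne])

lemma gamma_mul_volumeOperator_of_orthogonal {u : TSp q p x} (hu : ∀ i, g.val x u (e i) = 0) :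
    cl.gamma x u * cl.volumeOperator x e =
      (-1) ^ n * (cl.volumeOperator x e * cl.gamma x u) := by
  have h := mul_prod_of_anticommute (a := cl.gamma x u) (l := List.ofFn fun i ↦ cl.gamma x (e i))
    (by
      intro b hb
      obtain ⟨i, rfl⟩ := (List.mem_ofFn' _ _).1 hb
      exact cl.gamma_anticommute x (hu i))
  rw [List.length_ofFn] at h
  rw [volumeOperator, mul_smul_comm, h, smul_mul_assoc, mul_smul_comm]

lemma gamma_mul_volumeOperator_of_mem_span
    (he : ∀ i j, g.val x (e i) (e j) = if i = j then ε else 0) {u : TSp q p x}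
    (hu : u ∈ Submodule.span ℝ (Set.range e)) :
    cl.gamma x u * cl.volumeOperator x e =
      (-1) ^ (n + 1) * (cl.volumeOperator x e * cl.gamma x u) := by
  induction hu using Submodule.span_induction with
  | mem u hu =>
    obtain ⟨i, rfl⟩ := hu
    have h := mul_prod_of_mem (cl.pairwise_anticommute he) (a := cl.gamma x (e i))
      ((List.mem_ofFn' _ _).2 ⟨i, rfl⟩)
    rw [List.length_ofFn] at h
    rw [volumeOperator, mul_smul_comm, h, smul_mul_assoc, mul_smul_comm]
  | zero => simp [gamma_zero]
  | add u v _ _ hu hv => rw [gamma_add, add_mul, hu, hv, mul_add, mul_add]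
  | smul r u _ hu => rw [gamma_smul, smul_mul_assoc, hu, mul_smul_comm, mul_smul_comm]

lemma volumeOperator_mul_self (hn : Even n ∧ ε = -1 ∨ Odd n ∧ ε = 1)
    (he : ∀ i j, g.val x (e i) (e j) = if i = j then ε else 0) :
    cl.volumeOperator x e * cl.volumeOperator x e = 1 := by
  have h1 := prod_reverse_of_anticommute (cl.pairwise_anticommute he)
  have h2 := prod_mul_prod_reverse (l := List.ofFn fun i ↦ cl.gamma x (e i))
    (c := (ε : ℂ) • (1 : Module.End ℂ (S x))) (fun a ↦ (Commute.one_left a).smul_left _)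
    (by
      intro b hb
      obtain ⟨i, rfl⟩ := (List.mem_ofFn' _ _).1 hb
      rw [gamma_mul_self, he, if_pos rfl])
  -- The signs `(-1) ^ ⌊n/2⌋` of the reversal and of `i ^ ⌊n/2⌋ * i ^ ⌊n/2⌋` cancel.
  rw [h1, List.length_ofFn, neg_one_pow_choose_two] at h2
  have h3 : ((ε : ℂ) • (1 : Module.End ℂ (S x))) ^ n = 1 := by
    rcases hn with ⟨hn, rfl⟩ | ⟨hn, rfl⟩
    · simp [hn.neg_one_pow]
    · simp
  have hI : Complex.I ^ (n / 2) * Complex.I ^ (n / 2) = (-1) ^ (n / 2) := by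
    rw [← mul_pow, Complex.I_mul_I]
  have hs (a : Module.End ℂ (S x)) : (-1 : ℂ) ^ (n / 2) • a = (-1) ^ (n / 2) * a := by
    rcases Nat.even_or_odd (n / 2) with h' | h' <;> simp [h'.neg_one_pow]
  have hc (a : Module.End ℂ (S x)) : (-1) ^ (n / 2) * a = a * (-1) ^ (n / 2) :=
    (Commute.neg_one_left a).pow_left _
  rw [volumeOperator, smul_mul_smul_comm, hI, hs, ← mul_assoc, hc, mul_assoc, h2, h3]

end CliffordStructure

variable {cl : CliffordStructure F S g} {H : ∀ x : M, S x →ₗ⋆[ℂ] S x →ₗ[ℂ] ℂ}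

lemma IsRobinsonProduct.symm_prod (hH : IsRobinsonProduct cl H) {x : M} (l : List (TSp q p x))
    (ψ φ : S x) :
    H x ψ ((l.map (cl.gamma x)).prod φ) = H x ((l.map (cl.gamma x)).reverse.prod ψ) φ := by
  induction l generalizing ψ with
  | nil => simp
  | cons u t ih => simp [hH.selfAdjoint, ih]

lemma IsRobinsonProduct.symm_volumeOperator (hH : IsRobinsonProduct cl H) {x : M} {n : ℕ}
    {e : Fin n → TSp q p x} {ε : ℝ}
    (he : ∀ i j, g.val x (e i) (e j) = if i = j then ε else 0) (ψ φ : S x) :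
    H x ψ (cl.volumeOperator x e φ) = H x (cl.volumeOperator x e ψ) φ := by
  have h := hH.symm_prod (List.ofFn e) ψ φ
  rw [List.map_ofFn] at h
  have h1 := prod_reverse_of_anticommute (cl.pairwise_anticommute he)
  rw [List.length_ofFn, neg_one_pow_choose_two] at h1
  change H x ψ ((List.ofFn fun i ↦ cl.gamma x (e i)).prod φ) =
    H x ((List.ofFn fun i ↦ cl.gamma x (e i)).reverse.prod ψ) φ at h
  rw [h1] at h
  simp only [CliffordStructure.volumeOperator, LinearMap.smul_apply, map_smul, h,
    LinearMap.map_smulₛₗ, map_pow, Complex.conj_I]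
  rcases Nat.even_or_odd (n / 2) with h' | h' <;> simp [h'.neg_pow]

/-! ### The fundamental symmetry associated with a splitting -/

/-- `J` is the fundamental symmetry of `H_x` associated with the splitting, described without
frames: it is an `H_x`-self-adjoint involution that commutes with `γ(u)` for `u` in the positive
subspace, anticommutes with `γ(u)` for `u` in the negative subspace, and makes `H_x(·, J ·)`
positive definite. -/
structure IsAdapted (cl : CliffordStructure F S g) (spl : Splitting g)
    (H : ∀ x : M, S x →ₗ⋆[ℂ] S x →ₗ[ℂ] ℂ) (x : M) (J : Module.End ℂ (S x)) : Prop where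
  mul_self : J * J = 1
  commute (u : TSp q p x) : u ∈ spl.pos x → cl.gamma x u * J = J * cl.gamma x u
  anticommute (u : TSp q p x) : u ∈ spl.neg x → cl.gamma x u * J = -(J * cl.gamma x u)
  symm (ψ φ : S x) : H x ψ (J φ) = H x (J ψ) φ
  pos (ψ : S x) : ψ ≠ 0 → 0 < (H x ψ (J ψ)).re

variable {spl : Splitting g} {x : M}

/-- The product of two adapted involutions commutes with all of Clifford multiplication, hence is a
scalar; the scalar is `±1` since both are involutions, and `1` by positivity. -/
lemma IsAdapted.unique [FiniteDimensional ℂ F] {J J' : Module.End ℂ (S x)}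
    (h : IsAdapted cl spl H x J) (h' : IsAdapted cl spl H x J') : J = J' := by
  have : Nontrivial (S x) := cl.nontrivial_fibre x
  obtain ⟨c, hc⟩ := cl.eq_smul_one_of_commute (a := J * J') x (by
    intro u
    obtain ⟨v, hv, w, hw, rfl⟩ := Submodule.mem_sup.1
      ((spl.isCompl x).sup_eq_top ▸ Submodule.mem_top (x := u))
    rw [cl.gamma_add, mul_add, add_mul]
    congr 1
    · rw [← mul_assoc, h.anticommute v hv, neg_mul, mul_assoc J (cl.gamma x v), h'.anticommute v hv,
        mul_neg, neg_neg, mul_assoc]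
    · rw [← mul_assoc, h.commute w hw, mul_assoc J (cl.gamma x w), h'.commute w hw, mul_assoc])
  have hJ : J = c • J' := by
    rw [← mul_one J, ← h'.mul_self, ← mul_assoc, hc, smul_mul_assoc, one_mul]
  have hcc : c * c = 1 := by
    have h1 := h.mul_self
    rw [hJ, smul_mul_smul_comm, h'.mul_self] at h1
    obtain ⟨ψ, hψ⟩ := exists_ne (0 : S x)
    have h2 := LinearMap.congr_fun h1 ψ
    have h3 : (c * c - 1) • ψ = 0 := by
      rw [sub_smul, one_smul, sub_eq_zero]
      simpa using h2
    exact sub_eq_zero.1 ((smul_eq_zero.1 h3).resolve_right hψ)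
  rcases mul_self_eq_one_iff.1 hcc with rfl | rfl
  · rw [hJ, one_smul]
  · exfalso
    obtain ⟨ψ, hψ⟩ := exists_ne (0 : S x)
    have h1 := h.pos ψ hψ
    have h2 := h'.pos ψ hψ
    rw [hJ] at h1
    simp at h1
    linarith

lemma IsAdapted.isFundamentalSymmetry (hH : IsRobinsonProduct cl H) {J : Module.End ℂ (S x)}
    (h : IsAdapted cl spl H x J) : IsFundamentalSymmetry (H x) J :=
  isFundamentalSymmetry_of_involution (hH.hermitian x) h.mul_self h.symm h.pos

lemma gamma_mul_volumeOperator_of_splitting {n : ℕ} {e : Fin n → TSp q p x} {ε : ℝ}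
    (he : ∀ i j, g.val x (e i) (e j) = if i = j then ε else 0)
    (hs : Even n ∧ Submodule.span ℝ (Set.range e) = spl.neg x ∨
      Odd n ∧ Submodule.span ℝ (Set.range e) = spl.pos x) :
    (∀ u ∈ spl.pos x, cl.gamma x u * cl.volumeOperator x e =
      cl.volumeOperator x e * cl.gamma x u) ∧
    ∀ u ∈ spl.neg x, cl.gamma x u * cl.volumeOperator x e =
      -(cl.volumeOperator x e * cl.gamma x u) := by
  have hmem (i : Fin n) : e i ∈ Submodule.span ℝ (Set.range e) := Submodule.subset_span ⟨i, rfl⟩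
  rcases hs with ⟨hn, hs⟩ | ⟨hn, hs⟩
  · refine ⟨fun u hu ↦ ?_, fun u hu ↦ ?_⟩
    · rw [cl.gamma_mul_volumeOperator_of_orthogonal fun i ↦ by
        rw [g.symm]; exact spl.orthogonal x _ (hs ▸ hmem i) _ hu, hn.neg_one_pow, one_mul]
    · rw [cl.gamma_mul_volumeOperator_of_mem_span he (hs ▸ hu), hn.add_one.neg_one_pow]
      simp
  · refine ⟨fun u hu ↦ ?_, fun u hu ↦ ?_⟩
    · rw [cl.gamma_mul_volumeOperator_of_mem_span he (hs ▸ hu), hn.add_one.neg_one_pow, one_mul]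
    · rw [cl.gamma_mul_volumeOperator_of_orthogonal fun i ↦
        spl.orthogonal x _ hu _ (hs ▸ hmem i), hn.neg_one_pow]
      simp

/-- The form `H_x(·, Γ ·)` of the volume operator `Γ` is definite: it is invariant under Clifford
multiplication by unit vectors that are adapted to the splitting. -/
lemma exists_isAdapted_smul_volumeOperator [FiniteDimensional ℂ F] (hH : IsRobinsonProduct cl H)
    {n : ℕ} {e : Fin n → TSp q p x} {ε : ℝ} (hn : Even n ∧ ε = -1 ∨ Odd n ∧ ε = 1)
    (he : ∀ i j, g.val x (e i) (e j) = if i = j then ε else 0)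
    (hs : Even n ∧ Submodule.span ℝ (Set.range e) = spl.neg x ∨
      Odd n ∧ Submodule.span ℝ (Set.range e) = spl.pos x)
    {em : Fin q → TSp q p x} (hem : ∀ i j, g.val x (em i) (em j) = if i = j then -1 else 0)
    (hsm : Submodule.span ℝ (Set.range em) = spl.neg x)
    {ep : Fin p → TSp q p x} (hep : ∀ i j, g.val x (ep i) (ep j) = if i = j then 1 else 0)
    (hsp : Submodule.span ℝ (Set.range ep) = spl.pos x) :
    ∃ s : ℂ, (s = 1 ∨ s = -1) ∧ IsAdapted cl spl H x (s • cl.volumeOperator x e) := by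
  have : Nontrivial (S x) := cl.nontrivial_fibre x
  have : FiniteDimensional ℂ (S x) := finiteDimensional_fibre F x
  obtain ⟨hpos, hneg⟩ := gamma_mul_volumeOperator_of_splitting (cl := cl) he hs
  have hsq := cl.volumeOperator_mul_self hn he
  have hsa := hH.symm_volumeOperator he
  set Γ := cl.volumeOperator x e
  have hΓ (ψ : S x) : Γ (Γ ψ) = ψ := by simpa using LinearMap.congr_fun hsq ψ
  have hmem (i) : em i ∈ spl.neg x := hsm ▸ Submodule.subset_span ⟨i, rfl⟩
  have hpem (i) : ep i ∈ spl.pos x := hsp ▸ Submodule.subset_span ⟨i, rfl⟩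
  -- `v` is an orthonormal basis of the tangent space; the operators `γ(vᵢ)` square to `±1`,
  -- pairwise anticommute, and preserve the form `H_x(·, Γ ·)`.
  let v : Fin q ⊕ Fin p → TSp q p x := Sum.elim em ep
  have hv (i j) : g.val x (v i) (v j) = if i = j then Sum.elim (fun _ ↦ -1) (fun _ ↦ 1) i else 0 := by
    rcases i with i | i <;> rcases j with j | j
    · simp [v, hem]
    · simp [v, spl.orthogonal x _ (hmem i) _ (hpem j)]
    · simp [v, g.symm x (ep i), spl.orthogonal x _ (hmem j) _ (hpem i)]
    · simp [v, hep]
  let l : List (Module.End ℂ (S x)) := (Finset.univ.toList).map fun i ↦ cl.gamma x (v i)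
  have hl {b : Module.End ℂ (S x)} : b ∈ l ↔ ∃ i, cl.gamma x (v i) = b := by simp [l]
  have hlsq (i) : cl.gamma x (v i) * cl.gamma x (v i) = 1 ∨
      cl.gamma x (v i) * cl.gamma x (v i) = -1 := by
    rw [cl.gamma_mul_self, hv]
    rcases i with i | i <;> simp
  obtain ⟨h, hh, hinv⟩ := exists_invariant_isPosDefForm l
    (by
      intro b hb
      obtain ⟨i, rfl⟩ := hl.1 hb
      exact hlsq i)
    (by
      intro b hb c hc
      obtain ⟨i, rfl⟩ := hl.1 hb
      obtain ⟨j, rfl⟩ := hl.1 hc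
      by_cases hij : i = j
      · subst hij; exact Or.inl rfl
      · exact Or.inr (cl.gamma_anticommute x (by rw [hv, if_neg hij])))
  obtain ⟨s, hs1, hs2⟩ := definite_of_invariant (s := {b | b ∈ l}) (h := h)
    (B := (H x).compl₂ Γ)
    (by
      intro a ha
      refine cl.eq_smul_one_of_commute x fun u ↦ ?_
      have hu : u ∈ Submodule.span ℝ (Set.range v) := by
        rw [Set.Sum.elim_range, Submodule.span_union, hsm, hsp, (spl.isCompl x).sup_eq_top]
        trivial
      induction hu using Submodule.span_induction with
      | mem u hu =>
        obtain ⟨i, rfl⟩ := hu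
        exact ha _ (hl.2 ⟨i, rfl⟩)
      | zero => simp [cl.gamma_zero]
      | add u w _ _ hu hw => rw [cl.gamma_add, mul_add, add_mul, hu, hw]
      | smul r u _ hu => rw [cl.gamma_smul, mul_smul_comm, smul_mul_assoc, hu])
    (by
      intro b hb ψ
      obtain ⟨i, rfl⟩ := hl.1 hb
      rcases hlsq i with h1 | h1
      · exact ⟨cl.gamma x (v i) ψ, by simpa using LinearMap.congr_fun h1 ψ⟩
      · refine ⟨-(cl.gamma x (v i) ψ), ?_⟩
        have := LinearMap.congr_fun h1 ψ
        simp only [Module.End.mul_apply, LinearMap.neg_apply, Module.End.one_apply] at this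
        rw [map_neg, this, neg_neg])
    hh hinv
    (by
      intro ψ φ
      simp only [LinearMap.compl₂_apply, hH.hermitian, hsa])
    (by
      intro ψ h0
      refine hH.nondegenerate x ψ fun φ ↦ ?_
      rw [← hΓ φ]
      exact h0 (Γ φ))
    (by
      intro b hb ψ φ
      obtain ⟨i, rfl⟩ := hl.1 hb
      simp only [LinearMap.compl₂_apply]
      have hgg := LinearMap.congr_fun (cl.gamma_mul_self x (v i)) ψ
      rw [hv, if_pos rfl] at hgg
      rcases i with i | i
      · have h1 := LinearMap.congr_fun (hneg _ (hmem i)) φ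
        simp only [Module.End.mul_apply, LinearMap.neg_apply] at h1
        have h2 : Γ (cl.gamma x (v (Sum.inl i)) φ) = -(cl.gamma x (v (Sum.inl i)) (Γ φ)) := by
          rw [← neg_eq_iff_eq_neg]; exact h1.symm
        simp only [Module.End.mul_apply, Sum.elim_inl] at hgg
        rw [h2, map_neg, hH.selfAdjoint, hgg]
        simp
      · have h1 := LinearMap.congr_fun (hpos _ (hpem i)) φ
        simp only [Module.End.mul_apply] at h1
        have h2 : Γ (cl.gamma x (v (Sum.inr i)) φ) = cl.gamma x (v (Sum.inr i)) (Γ φ) := h1.symm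
        simp only [Module.End.mul_apply, Sum.elim_inr] at hgg
        rw [h2, hH.selfAdjoint, hgg]
        simp)
  have hss : (s : ℂ) * s = 1 := by rcases hs1 with rfl | rfl <;> simp
  refine ⟨s, by rcases hs1 with rfl | rfl <;> simp, ⟨?_, fun u hu ↦ ?_, fun u hu ↦ ?_,
    fun ψ φ ↦ ?_, fun ψ hψ ↦ ?_⟩⟩
  · rw [smul_mul_smul_comm, hss, hsq, one_smul]
  · rw [mul_smul_comm, hpos u hu, smul_mul_assoc]
  · rw [mul_smul_comm, hneg u hu, smul_mul_assoc, smul_neg]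
  · simp only [LinearMap.smul_apply, map_smul, hsa, LinearMap.map_smulₛₗ, Complex.conj_ofReal]
  · have := hs2 ψ hψ
    simpa using this

end Fibre

/-! ### Smooth orthonormal frames -/

section Frames

open scoped Topology

variable {q p : ℕ} {M : Type*} [TopologicalSpace M]
  [ChartedSpace (EuclideanSpace ℝ (Fin (q + p))) M] [IsManifold (𝓡 (q + p)) ∞ M]

lemma Metric.contMDiffAt_apply (g : Metric q p M) {E' : Type*} [NormedAddCommGroup E']
    [NormedSpace ℝ E'] {H' : Type*} [TopologicalSpace H'] {I' : ModelWithCorners ℝ E' H'}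
    {N : Type*} [TopologicalSpace N] [ChartedSpace H' N] {b : N → M} {v w : ∀ y, TSp q p (b y)}
    {y : N}
    (hv : ContMDiffAt I' (𝓡 (q + p)).tangent ∞
      (fun y ↦ (TotalSpace.mk' (EuclideanSpace ℝ (Fin (q + p))) (b y) (v y) :
        TangentBundle (𝓡 (q + p)) M)) y)
    (hw : ContMDiffAt I' (𝓡 (q + p)).tangent ∞
      (fun y ↦ (TotalSpace.mk' (EuclideanSpace ℝ (Fin (q + p))) (b y) (w y) :
        TangentBundle (𝓡 (q + p)) M)) y) :
    ContMDiffAt I' 𝓘(ℝ, ℝ) ∞ (fun y ↦ g.val (b y) (v y) (w y)) y := by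
  have hb : ContMDiffAt I' (𝓡 (q + p)) ∞ b y := (contMDiffAt_totalSpace.1 hv).1
  have h : ContMDiffAt I' ((𝓡 (q + p)).prod 𝓘(ℝ, ℝ)) ∞
      (fun y ↦ TotalSpace.mk' ℝ (E := Bundle.Trivial M ℝ) (b y) (g.val (b y) (v y) (w y))) y := by
    apply ContMDiffAt.clm_bundle_apply₂ (F₁ := EuclideanSpace ℝ (Fin (q + p)))
      (F₂ := EuclideanSpace ℝ (Fin (q + p)))
    · exact ContMDiffAt.comp y g.contMDiff.contMDiffAt hb
    · exact hv
    · exact hw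
  exact (contMDiffAt_totalSpace.1 h).2

/-- Replacing the last vector of a family by a nonzero multiple of its difference with a vector in
the span of the others, as the Gram–Schmidt process does, does not change the span. -/
lemma span_range_snoc_sub {V : Type*} [AddCommGroup V] [Module ℝ V] {k : ℕ} {e : Fin k → V}
    {X : Fin (k + 1) → V} {z : V} {r : ℝ} (hr : r ≠ 0)
    (hspan : Submodule.span ℝ (Set.range e) =
      Submodule.span ℝ (Set.range fun i : Fin k ↦ X i.castSucc))
    (hz : z ∈ Submodule.span ℝ (Set.range e)) :
    Submodule.span ℝ (Set.range (Fin.snoc e (r • (X (Fin.last k) - z)) : Fin (k + 1) → V)) =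
      Submodule.span ℝ (Set.range X) := by
  have hX : X = Fin.snoc (fun i : Fin k ↦ X i.castSucc) (X (Fin.last k)) :=
    (Fin.snoc_init_self X).symm
  rw [hX, Fin.range_snoc, Fin.range_snoc]
  simp only [Fin.snoc_last]
  rw [Submodule.span_insert, Submodule.span_insert, hspan,
    Submodule.span_singleton_smul_eq hr.isUnit]
  rw [hspan] at hz
  set P := Submodule.span ℝ (Set.range fun i : Fin k ↦ X i.castSucc)
  have hzl (T : Submodule ℝ V) : z ∈ T ⊔ P := Submodule.mem_sup_right hz
  apply le_antisymm
  · refine sup_le ?_ le_sup_right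
    rw [Submodule.span_singleton_le_iff_mem]
    exact sub_mem (Submodule.mem_sup_left (Submodule.mem_span_singleton_self _)) (hzl _)
  · refine sup_le ?_ le_sup_right
    rw [Submodule.span_singleton_le_iff_mem]
    rw [← sub_add_cancel (X (Fin.last k)) z]
    refine add_mem (Submodule.mem_sup_left ?_) (hzl _)
    rw [sub_add_cancel]
    exact Submodule.mem_span_singleton_self _

/-- The Gram–Schmidt process for a smooth frame on whose span the metric is definite of sign `ε`. -/
lemma exists_smooth_gramSchmidt (g : Metric q p M) {ε : ℝ} (hε : ε = 1 ∨ ε = -1) {U : Set M}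
    {k : ℕ} (X : Fin k → ∀ x : M, TSp q p x) (hX : ∀ i, ∀ x ∈ U, SmoothFieldAt q p (X i) x)
    (hli : ∀ x ∈ U, LinearIndependent ℝ fun i ↦ X i x)
    (hdef : ∀ x ∈ U, ∀ v ∈ Submodule.span ℝ (Set.range fun i ↦ X i x), v ≠ 0 →
      0 < ε * g.val x v v) :
    ∃ e : Fin k → ∀ x : M, TSp q p x, (∀ i, ∀ x ∈ U, SmoothFieldAt q p (e i) x) ∧
      ∀ x ∈ U, (∀ i j, g.val x (e i x) (e j x) = if i = j then ε else 0) ∧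
        Submodule.span ℝ (Set.range fun i ↦ e i x) =
          Submodule.span ℝ (Set.range fun i ↦ X i x) := by
  have hεε : ε * ε = 1 := by rcases hε with rfl | rfl <;> norm_num
  induction k with
  | zero => exact ⟨X, hX, fun x _ ↦ ⟨fun i ↦ i.elim0, rfl⟩⟩
  | succ k ih =>
    have hsub (x : M) : Submodule.span ℝ (Set.range fun i : Fin k ↦ X i.castSucc x) ≤
        Submodule.span ℝ (Set.range fun i ↦ X i x) :=
      Submodule.span_mono (by rintro _ ⟨i, rfl⟩; exact ⟨i.castSucc, rfl⟩)
    obtain ⟨e, he, hex⟩ := ih (fun i ↦ X i.castSucc) (fun i ↦ hX _)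
      (fun x hx ↦ (hli x hx).comp _ (Fin.castSucc_injective k))
      fun x hx v hv ↦ hdef x hx v (hsub x hv)
    let Z : ∀ x : M, TSp q p x := fun x ↦
      ∑ i, (ε * g.val x (X (Fin.last k) x) (e i x)) • e i x
    let Y : ∀ x : M, TSp q p x := fun x ↦ X (Fin.last k) x - Z x
    let r : M → ℝ := fun x ↦ (√(ε * g.val x (Y x) (Y x)))⁻¹
    have hYX (x : M) : Y x = X (Fin.last k) x - Z x := rfl
    have hZ {x : M} : Z x ∈ Submodule.span ℝ (Set.range fun i ↦ e i x) :=
      Submodule.sum_mem _ fun i _ ↦ Submodule.smul_mem _ _ (Submodule.subset_span ⟨i, rfl⟩)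
    have hYe {x : M} (hx : x ∈ U) (j : Fin k) : g.val x (Y x) (e j x) = 0 := by
      simp only [Y, Z, map_sub, map_sum, map_smul, sub_apply, sum_apply,
        smul_apply, (hex x hx).1, smul_eq_mul, mul_ite, mul_zero,
        Finset.sum_ite_eq', Finset.mem_univ, if_true]
      linear_combination (-(g.val x (X (Fin.last k) x) (e j x))) * hεε
    have hY0 {x : M} (hx : x ∈ U) : 0 < ε * g.val x (Y x) (Y x) := by
      apply hdef x hx
      · exact sub_mem (Submodule.subset_span ⟨_, rfl⟩) (hsub x ((hex x hx).2 ▸ hZ))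
      · intro h0
        have hmem : X (Fin.last k) x ∈
            Submodule.span ℝ (Set.range fun i : Fin k ↦ X i.castSucc x) := by
          rw [sub_eq_zero.1 h0]
          exact (hex x hx).2 ▸ hZ
        have hl := hli x hx
        rw [show (fun i ↦ X i x) = Fin.snoc (fun i : Fin k ↦ X i.castSucc x) (X (Fin.last k) x)
          from (Fin.snoc_init_self fun i ↦ X i x).symm, linearIndependent_finSnoc] at hl
        exact hl.2 hmem
    have hr {x : M} (hx : x ∈ U) : r x ≠ 0 := inv_ne_zero (Real.sqrt_ne_zero'.2 (hY0 hx))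
    have hYs {x : M} (hx : x ∈ U) : SmoothFieldAt q p Y x := by
      refine ContMDiffAt.sub_section (hX _ x hx) (ContMDiffAt.sum_section fun i _ ↦ ?_)
      refine ContMDiffAt.smul_section ?_ (he i x hx)
      exact contMDiffAt_const.mul (g.contMDiffAt_apply (hX _ x hx) (he i x hx))
    have hrs {x : M} (hx : x ∈ U) : ContMDiffAt (𝓡 (q + p)) 𝓘(ℝ, ℝ) ∞ r x := by
      have h1 : ContMDiffAt (𝓡 (q + p)) 𝓘(ℝ, ℝ) ∞ (fun x ↦ ε * g.val x (Y x) (Y x)) x :=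
        contMDiffAt_const.mul (g.contMDiffAt_apply (hYs hx) (hYs hx))
      have h2 : ContDiffAt ℝ ∞ (fun t : ℝ ↦ (√t)⁻¹) (ε * g.val x (Y x) (Y x)) :=
        (Real.contDiffAt_sqrt (hY0 hx).ne').inv (Real.sqrt_ne_zero'.2 (hY0 hx))
      exact ContMDiffAt.comp (g := fun t : ℝ ↦ (√t)⁻¹) x h2.contMDiffAt h1
    refine ⟨fun i x ↦ (Fin.snoc (fun i : Fin k ↦ e i x) (r x • Y x) : Fin (k + 1) → TSp q p x) i,
      fun i ↦ ?_, fun x hx ↦ ⟨fun i j ↦ ?_, ?_⟩⟩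
    · refine Fin.lastCases ?_ (fun i ↦ ?_) i
      · intro x hx
        simp only [Fin.snoc_last]
        exact ContMDiffAt.smul_section (hrs hx) (hYs hx)
      · simpa only [Fin.snoc_castSucc] using he i
    · refine Fin.lastCases ?_ (fun i ↦ ?_) i <;> refine Fin.lastCases ?_ (fun j ↦ ?_) j
      · simp only [Fin.snoc_last, map_smul, smul_apply, smul_eq_mul, if_true]
        have h1 : r x * r x * (ε * g.val x (Y x) (Y x)) = 1 := by
          rw [← mul_inv, Real.mul_self_sqrt (hY0 hx).le, inv_mul_cancel₀ (hY0 hx).ne']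
        linear_combination ε * h1 - r x * r x * g.val x (Y x) (Y x) * hεε
      · simp [hYe hx, Fin.ext_iff, j.2.ne']
      · simp [g.symm x (e i x), hYe hx, Fin.ext_iff, i.2.ne]
      · simp [(hex x hx).1]
    · exact span_range_snoc_sub (X := fun i ↦ X i x) (hr hx) (hex x hx).2 hZ

/-- A subbundle on which the metric is definite has smooth local orthonormal frames. -/
lemma IsSmoothSubbundle.exists_orthonormal_frame (g : Metric q p M) {ε : ℝ} (hε : ε = 1 ∨ ε = -1)
    {k : ℕ} {E : ∀ x : M, Submodule ℝ (TSp q p x)} (hE : IsSmoothSubbundle k E)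
    (hdef : ∀ x, ∀ v ∈ E x, v ≠ 0 → 0 < ε * g.val x v v) (x₀ : M) :
    ∃ U ∈ 𝓝 x₀, ∃ e : Fin k → ∀ x : M, TSp q p x, (∀ i, ∀ x ∈ U, SmoothFieldAt q p (e i) x) ∧
      ∀ x ∈ U, (∀ i j, g.val x (e i x) (e j x) = if i = j then ε else 0) ∧
        Submodule.span ℝ (Set.range fun i ↦ e i x) = E x := by
  obtain ⟨U, hU, hx₀, X, hX, hspan⟩ := hE x₀
  obtain ⟨e, he, hex⟩ := exists_smooth_gramSchmidt g hε X hX (fun x hx ↦ (hspan x hx).1)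
    fun x hx v hv ↦ hdef x v ((hspan x hx).2 ▸ hv)
  exact ⟨U, hU.mem_nhds hx₀, e, he, fun x hx ↦ ⟨(hex x hx).1, (hex x hx).2.trans (hspan x hx).2⟩⟩

lemma Splitting.exists_orthonormal_frame_neg {g : Metric q p M} (spl : Splitting g) (x₀ : M) :
    ∃ U ∈ 𝓝 x₀, ∃ e : Fin q → ∀ x : M, TSp q p x, (∀ i, ∀ x ∈ U, SmoothFieldAt q p (e i) x) ∧
      ∀ x ∈ U, (∀ i j, g.val x (e i x) (e j x) = if i = j then -1 else 0) ∧
        Submodule.span ℝ (Set.range fun i ↦ e i x) = spl.neg x :=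
  spl.smooth_neg.exists_orthonormal_frame g (Or.inr rfl)
    (fun x v hv h0 ↦ by linarith [spl.neg_def x v hv h0]) x₀

lemma Splitting.exists_orthonormal_frame_pos {g : Metric q p M} (spl : Splitting g) (x₀ : M) :
    ∃ U ∈ 𝓝 x₀, ∃ e : Fin p → ∀ x : M, TSp q p x, (∀ i, ∀ x ∈ U, SmoothFieldAt q p (e i) x) ∧
      ∀ x ∈ U, (∀ i j, g.val x (e i x) (e j x) = if i = j then 1 else 0) ∧
        Submodule.span ℝ (Set.range fun i ↦ e i x) = spl.pos x :=
  spl.smooth_pos.exists_orthonormal_frame g (Or.inl rfl)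
    (fun x v hv h0 ↦ by linarith [spl.pos_def x v hv h0]) x₀

/-- An orthonormal family of the right cardinality in a subspace spans it. -/
lemma span_eq_of_orthonormal (g : Metric q p M) {ε : ℝ} (hε : ε ≠ 0) {x : M} {k : ℕ}
    {E : Submodule ℝ (TSp q p x)} {e e' : Fin k → TSp q p x} (hmem : ∀ i, e i ∈ E)
    (he : ∀ i j, g.val x (e i) (e j) = if i = j then ε else 0)
    (he' : Submodule.span ℝ (Set.range e') = E) :
    Submodule.span ℝ (Set.range e) = E := by
  have hli : LinearIndependent ℝ e := by
    rw [Fintype.linearIndependent_iff]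
    intro c hc i
    have h := congrArg (fun v ↦ g.val x v (e i)) hc
    simpa [he, hε] using h
  have hfin : FiniteDimensional ℝ E := he' ▸ FiniteDimensional.span_of_finite ℝ (Set.finite_range e')
  refine Submodule.eq_of_le_of_finrank_le ?_ ?_
  · rw [Submodule.span_le]
    rintro _ ⟨i, rfl⟩
    exact hmem i
  · rw [finrank_span_eq_card hli, ← he']
    exact finrank_range_le_card e'

end Frames

section Symmetry

open scoped Topology

variable {q p : ℕ} {M : Type*} [TopologicalSpace M]
  [ChartedSpace (EuclideanSpace ℝ (Fin (q + p))) M] [IsManifold (𝓡 (q + p)) ∞ M]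
  {F : Type*} [NormedAddCommGroup F] [NormedSpace ℂ F]
  {S : M → Type*} [TopologicalSpace (TotalSpace F S)]
  [∀ x, AddCommGroup (S x)] [∀ x, Module ℂ (S x)] [∀ x, TopologicalSpace (S x)]
  [FiberBundle F S] [VectorBundle ℂ F S] [VectorBundle ℝ F S]
  [ContMDiffVectorBundle ∞ F S (𝓡 (q + p))]
  {g : Metric q p M} {cl : CliffordStructure F S g} {spl : Splitting g}
  {H : ∀ x : M, S x →ₗ⋆[ℂ] S x →ₗ[ℂ] ℂ}

/-! ### Existence and uniqueness of the fundamental symmetry of a splitting -/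

/-- Near each point, the adapted fundamental symmetries are, up to a sign at each point, the volume
operators of a single smooth orthonormal frame: of the negative subbundle if `q` is even, and of the
positive one if `q` is odd. -/
lemma exists_local_frame_isAdapted [FiniteDimensional ℂ F] (heven : Even (q + p))
    (hH : IsRobinsonProduct cl H) (x₀ : M) :
    ∃ U ∈ 𝓝 x₀, ∃ (n : ℕ) (e : Fin n → ∀ x : M, TSp q p x),
      (∀ i, ∀ x ∈ U, SmoothFieldAt q p (e i) x) ∧
      (∀ x ∈ U, ∃ s : ℂ, (s = 1 ∨ s = -1) ∧
        IsAdapted cl spl H x (s • cl.volumeOperator x fun i ↦ e i x)) ∧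
      (Even q ∧ n = q ∧ (∀ x ∈ U, (∀ i, e i x ∈ spl.neg x) ∧
          ∀ i j, g.val x (e i x) (e j x) = if i = j then -1 else 0) ∨
        ¬ Even q ∧ n = p ∧ (∀ x ∈ U, (∀ i, e i x ∈ spl.pos x) ∧
          ∀ i j, g.val x (e i x) (e j x) = if i = j then 1 else 0)) := by
  obtain ⟨U, hU, em, hem, hm⟩ := spl.exists_orthonormal_frame_neg x₀
  obtain ⟨U', hU', ep, hep, hp⟩ := spl.exists_orthonormal_frame_pos x₀
  by_cases hq : Even q
  · refine ⟨U ∩ U', Filter.inter_mem hU hU', q, em, fun i x hx ↦ hem i x hx.1, fun x hx ↦ ?_,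
      Or.inl ⟨hq, rfl, fun x hx ↦ ⟨fun i ↦ ?_, (hm x hx.1).1⟩⟩⟩
    · exact exists_isAdapted_smul_volumeOperator hH (Or.inl ⟨hq, rfl⟩) (hm x hx.1).1
        (Or.inl ⟨hq, (hm x hx.1).2⟩) (hm x hx.1).1 (hm x hx.1).2 (hp x hx.2).1 (hp x hx.2).2
    · exact (hm x hx.1).2 ▸ Submodule.subset_span ⟨i, rfl⟩
  · have hp' : Odd p := by
      rw [Nat.even_add] at heven
      exact Nat.not_even_iff_odd.1 fun h ↦ hq (heven.2 h)
    refine ⟨U ∩ U', Filter.inter_mem hU hU', p, ep, fun i x hx ↦ hep i x hx.2, fun x hx ↦ ?_,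
      Or.inr ⟨hq, rfl, fun x hx ↦ ⟨fun i ↦ ?_, (hp x hx.2).1⟩⟩⟩
    · exact exists_isAdapted_smul_volumeOperator hH (Or.inr ⟨hp', rfl⟩) (hp x hx.2).1
        (Or.inr ⟨hp', (hp x hx.2).2⟩) (hm x hx.1).1 (hm x hx.1).2 (hp x hx.2).1 (hp x hx.2).2
    · exact (hp x hx.2).2 ▸ Submodule.subset_span ⟨i, rfl⟩

lemma sub_one_div_two_of_not_even (heven : Even (q + p)) (hq : ¬ Even q) :
    (p - 1) / 2 = p / 2 := by
  rw [Nat.even_add] at heven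
  obtain ⟨k, hk⟩ := Nat.not_even_iff_odd.1 fun h ↦ hq (heven.2 h)
  omega

/-- The frame-free description of the fundamental symmetry associated with a splitting. -/
lemma isSplittingSymmetry_iff [FiniteDimensional ℂ F] (heven : Even (q + p))
    (hH : IsRobinsonProduct cl H) {η : ∀ x : M, S x →ₗ[ℂ] S x} :
    IsSplittingSymmetry cl spl H η ↔ ∀ x, IsAdapted cl spl H x (η x) := by
  refine ⟨fun h x ↦ ?_, fun h x ↦ ⟨(h x).isFundamentalSymmetry hH, ?_⟩⟩
  · obtain ⟨hf, s, -, hs⟩ := h x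
    obtain ⟨Um, hUm, em, -, hm⟩ := spl.exists_orthonormal_frame_neg x
    obtain ⟨Up, hUp, ep, -, hp⟩ := spl.exists_orthonormal_frame_pos x
    have key : (∀ u ∈ spl.pos x, cl.gamma x u * η x = η x * cl.gamma x u) ∧
        ∀ u ∈ spl.neg x, cl.gamma x u * η x = -(η x * cl.gamma x u) := by
      split_ifs at hs with hq
      · obtain ⟨e, he, hon, hη⟩ := hs
        have h1 := gamma_mul_volumeOperator_of_splitting (cl := cl) (spl := spl) hon
          (Or.inl ⟨hq, span_eq_of_orthonormal g (by norm_num) he hon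
            (hm x (mem_of_mem_nhds hUm)).2⟩)
        have hη' : η x = s • cl.volumeOperator x e := by
          rw [hη, CliffordStructure.volumeOperator, smul_smul]
        rw [hη']
        exact ⟨fun u hu ↦ by rw [mul_smul_comm, h1.1 u hu, smul_mul_assoc],
          fun u hu ↦ by rw [mul_smul_comm, h1.2 u hu, smul_mul_assoc, smul_neg]⟩
      · have hpo : Odd p := by
          rw [Nat.even_add] at heven
          exact Nat.not_even_iff_odd.1 fun h ↦ hq (heven.2 h)
        obtain ⟨e, he, hon, hη⟩ := hs
        have h1 := gamma_mul_volumeOperator_of_splitting (cl := cl) (spl := spl) hon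
          (Or.inr ⟨hpo, span_eq_of_orthonormal g (by norm_num) he hon
            (hp x (mem_of_mem_nhds hUp)).2⟩)
        have hη' : η x = s • cl.volumeOperator x e := by
          rw [hη, CliffordStructure.volumeOperator, smul_smul,
            sub_one_div_two_of_not_even heven hq]
        rw [hη']
        exact ⟨fun u hu ↦ by rw [mul_smul_comm, h1.1 u hu, smul_mul_assoc],
          fun u hu ↦ by rw [mul_smul_comm, h1.2 u hu, smul_mul_assoc, smul_neg]⟩
    exact ⟨hf.mul_self, key.1, key.2, hf.symm_apply, fun ψ hψ ↦ hf.pos hψ⟩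
  · obtain ⟨U, hU, n, e, -, hs, hcase⟩ :=
      exists_local_frame_isAdapted (spl := spl) heven hH x
    have hx := mem_of_mem_nhds hU
    obtain ⟨s, hs1, hs⟩ := hs x hx
    refine ⟨s, hs1, ?_⟩
    rw [(h x).unique hs]
    rcases hcase with ⟨hq, rfl, he⟩ | ⟨hq, rfl, he⟩
    · rw [if_pos hq]
      refine ⟨fun i ↦ e i x, (he x hx).1, (he x hx).2, ?_⟩
      rw [CliffordStructure.volumeOperator, smul_smul]
    · rw [if_neg hq]
      refine ⟨fun i ↦ e i x, (he x hx).1, (he x hx).2, ?_⟩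
      rw [CliffordStructure.volumeOperator, smul_smul, sub_one_div_two_of_not_even heven hq]

lemma existsUnique_isSplittingSymmetry [FiniteDimensional ℂ F] (heven : Even (q + p))
    (hH : IsRobinsonProduct cl H) : ∃! η, IsSplittingSymmetry cl spl H η := by
  have hex (x : M) : ∃ J, IsAdapted cl spl H x J := by
    obtain ⟨U, hU, n, e, -, hs, -⟩ := exists_local_frame_isAdapted (spl := spl) heven hH x
    obtain ⟨s, -, hs⟩ := hs x (mem_of_mem_nhds hU)
    exact ⟨_, hs⟩
  choose η hη using hex
  refine ⟨η, (isSplittingSymmetry_iff heven hH).2 hη, fun η' h' ↦ ?_⟩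
  ext1 x
  exact ((isSplittingSymmetry_iff heven hH).1 h' x).unique (hη x)

lemma isAdapted_splittingSymmetry [FiniteDimensional ℂ F] (heven : Even (q + p))
    (hH : IsRobinsonProduct cl H) (x : M) :
    IsAdapted cl spl H x (splittingSymmetry cl spl H x) := by
  have h := (existsUnique_isSplittingSymmetry (spl := spl) heven hH).exists
  rw [splittingSymmetry, dif_pos h]
  exact (isSplittingSymmetry_iff heven hH).1 h.choose_spec x

lemma splittingSymmetry_splittingSymmetry [FiniteDimensional ℂ F] (heven : Even (q + p))
    (hH : IsRobinsonProduct cl H) (x : M) (ψ : S x) :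
    splittingSymmetry cl spl H x (splittingSymmetry cl spl H x ψ) = ψ :=
  LinearMap.congr_fun (isAdapted_splittingSymmetry (spl := spl) heven hH x).mul_self ψ

/-! ### Smooth sections -/

lemma SmoothSectionAt.const_smul {ψ : ∀ x : M, S x} {x₀ : M} (h : SmoothSectionAt q p F ψ x₀)
    (c : ℂ) : SmoothSectionAt q p F (fun x ↦ c • ψ x) x₀ := by
  unfold SmoothSectionAt at h ⊢
  rw [contMDiffAt_section] at h ⊢
  have h2 : ContMDiffAt (𝓡 (q + p)) 𝓘(ℝ, F) ∞
      (fun x ↦ c • (trivializationAt F S x₀ (TotalSpace.mk' F x (ψ x))).2) x₀ :=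
    ContMDiffAt.comp (g := fun v : F ↦ c • v) x₀ (contDiff_const_smul c).contMDiff.contMDiffAt h
  refine h2.congr_of_eventuallyEq ?_
  filter_upwards [(trivializationAt F S x₀).open_baseSet.mem_nhds
    (FiberBundle.mem_baseSet_trivializationAt' x₀)] with x hx
  exact ((trivializationAt F S x₀).linear ℂ hx).map_smul c (ψ x)

lemma SmoothSectionAt.congr {ψ φ : ∀ x : M, S x} {x₀ : M} (h : SmoothSectionAt q p F ψ x₀)
    (heq : ∀ᶠ x in 𝓝 x₀, φ x = ψ x) : SmoothSectionAt q p F φ x₀ :=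
  ContMDiffAt.congr_of_eventuallyEq h (heq.mono fun x hx ↦ by simp only [hx])

lemma CliffordStructure.smoothSectionAt_volumeOperator (cl : CliffordStructure F S g) {n : ℕ}
    {e : Fin n → ∀ x : M, TSp q p x} {ψ : ∀ x : M, S x} {x₀ : M}
    (he : ∀ i, SmoothFieldAt q p (e i) x₀) (hψ : SmoothSectionAt q p F ψ x₀) :
    SmoothSectionAt q p F (fun x ↦ cl.volumeOperator x (fun i ↦ e i x) (ψ x)) x₀ := by
  have key (l : List (∀ x : M, TSp q p x)) (hl : ∀ X ∈ l, SmoothFieldAt q p X x₀) :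
      SmoothSectionAt q p F (fun x ↦ (l.map fun X ↦ cl.gamma x (X x)).prod (ψ x)) x₀ := by
    induction l with
    | nil => simpa using hψ
    | cons X t ih =>
      simp only [List.map_cons, List.prod_cons, Module.End.mul_apply]
      exact cl.smooth x₀ X _ (hl X List.mem_cons_self)
        (ih fun Y hY ↦ hl Y (List.mem_cons_of_mem _ hY))
  have h := (key (List.ofFn e) (by
    intro X hX
    obtain ⟨i, rfl⟩ := (List.mem_ofFn' _ _).1 hX
    exact he i)).const_smul (Complex.I ^ (n / 2))
  simp only [List.map_ofFn] at h
  exact h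

/-- There are compactly supported smooth sections with a prescribed value at a point and support in
a prescribed neighbourhood of that point. -/
lemma exists_compactSpinor [T2Space M] {x : M} {W : Set M} (hW : W ∈ 𝓝 x) (v : S x) :
    ∃ ψ ∈ CompactSpinors q p F S, ψ x = v ∧ ∀ y ∉ W, ψ y = 0 := by
  let e := trivializationAt F S x
  have hx : x ∈ e.baseSet := FiberBundle.mem_baseSet_trivializationAt' x
  obtain ⟨f, -, hf⟩ := (SmoothBumpFunction.nhds_basis_tsupport (I := 𝓡 (q + p)) x).mem_iff.1
    (Filter.inter_mem hW (e.open_baseSet.mem_nhds hx))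
  -- The section that is constant in the trivialization at `x`, cut off by a bump function.
  let σ : ∀ y : M, S y := fun y ↦ e.symm y (e ⟨x, v⟩).2
  have hσ : ContMDiffOn (𝓡 (q + p)) ((𝓡 (q + p)).prod 𝓘(ℝ, F)) ∞
      (fun y ↦ TotalSpace.mk' F y (σ y)) e.baseSet := by
    rw [e.contMDiffOn_section_baseSet_iff]
    refine (contMDiffOn_const (c := (e ⟨x, v⟩).2)).congr fun y hy ↦ ?_
    simp [σ, e.apply_mk_symm hy]
  refine ⟨fun y ↦ f y • σ y, ⟨fun y ↦ ?_, ?_⟩, ?_, fun y hy ↦ ?_⟩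
  · exact ContMDiffOn.smul_section_of_tsupport (ψ := f) (s := σ) f.contMDiff.contMDiffOn
      e.open_baseSet (hf.trans Set.inter_subset_right) hσ y
  · refine f.hasCompactSupport.of_isClosed_subset isClosed_closure (closure_mono fun y hy h0 ↦ ?_)
    exact hy (by simp [h0])
  · simp only [f.eq_one, one_smul, σ]
    exact e.symm_apply_apply_mk hx v
  · have : f y = 0 := image_eq_zero_of_notMem_tsupport fun h ↦ hy (hf h).1
    simp [this]

/-- On the domain of a smooth frame, the fundamental symmetry is the volume operator of the frame up
to a sign, and the sign is locally constant because it is the sign of the continuous nonvanishing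
function `x ↦ H_x(φ, Γ_x φ)`, for a local section `φ` without zeros. -/
theorem smoothEnd_splittingSymmetry [T2Space M] [FiniteDimensional ℂ F] (heven : Even (q + p))
    (hH : IsRobinsonProduct cl H) : SmoothEnd q p F (splittingSymmetry cl spl H) := by
  intro x₀ ψ hψ
  obtain ⟨U, hU, n, e, he, hs, -⟩ := exists_local_frame_isAdapted (spl := spl) heven hH x₀
  have hx₀ := mem_of_mem_nhds hU
  have := cl.nontrivial_fibre x₀
  obtain ⟨v, hv⟩ := exists_ne (0 : S x₀)
  obtain ⟨φ, hφ, hφv, -⟩ := exists_compactSpinor (q := q) (p := p) (F := F)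
    (Filter.univ_mem (f := 𝓝 x₀)) v
  set Γ : ∀ x, Module.End ℂ (S x) := fun x ↦ cl.volumeOperator x fun i ↦ e i x
  let f : M → ℝ := fun x ↦ (H x (φ x) (Γ x (φ x))).re
  have hf : ContinuousAt f x₀ := Complex.continuous_re.continuousAt.comp
    (hH.smooth x₀ _ _ (hφ.1 x₀)
      (cl.smoothSectionAt_volumeOperator (fun i ↦ he i x₀ hx₀) (hφ.1 x₀))).continuousAt
  have hη (x : M) (hx : x ∈ U) : ∃ s : ℝ, (s = 1 ∨ s = -1) ∧
      splittingSymmetry cl spl H x = (s : ℂ) • Γ x ∧ (φ x ≠ 0 → 0 < s * f x) := by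
    obtain ⟨s, hs1, hs2⟩ := hs x hx
    have h := (isAdapted_splittingSymmetry (spl := spl) heven hH x).unique hs2
    have hpos : φ x ≠ 0 → 0 < (s * H x (φ x) (Γ x (φ x))).re := fun h0 ↦ by
      simpa using hs2.pos (φ x) h0
    rcases hs1 with rfl | rfl
    · exact ⟨1, Or.inl rfl, by simpa using h, by simpa [f] using hpos⟩
    · exact ⟨-1, Or.inr rfl, by simpa using h, by simpa [f] using hpos⟩
  obtain ⟨s, hs1, -, hs3⟩ := hη x₀ hx₀
  have hs3 := hs3 (hφv ▸ hv)
  have hev : ∀ᶠ x in 𝓝 x₀, splittingSymmetry cl spl H x (ψ x) = (s : ℂ) • Γ x (ψ x) := by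
    filter_upwards [hU, (continuousAt_const.mul hf).eventually (lt_mem_nhds hs3)] with x hx hlt
    have hlt : 0 < s * f x := hlt
    obtain ⟨t, ht1, ht2, ht3⟩ := hη x hx
    have h0 : φ x ≠ 0 := by
      intro h0
      simp [f, h0] at hlt
    have ht3 := ht3 h0
    have hst : t = s := by
      rcases hs1 with rfl | rfl <;> rcases ht1 with rfl | rfl
      · rfl
      · linarith
      · linarith
      · rfl
    rw [ht2, hst]
    rfl
  exact ((cl.smoothSectionAt_volumeOperator (fun i ↦ he i x₀ hx₀) hψ).const_smul s).congr hev

end Symmetry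

/-! ### The semi-Riemannian volume measure -/

section Volume

open scoped Topology

variable {q p : ℕ} {M : Type*} [TopologicalSpace M]
  [ChartedSpace (EuclideanSpace ℝ (Fin (q + p))) M] [IsManifold (𝓡 (q + p)) ∞ M]

lemma det_bilinForm_comp {E ι : Type*} [AddCommGroup E] [Module ℝ E] [Fintype ι] [DecidableEq ι]
    (b : Module.Basis ι ℝ E) (β : LinearMap.BilinForm ℝ E) (f : E →ₗ[ℝ] E) :
    (Matrix.of fun i j ↦ β (f (b i)) (f (b j))).det =
      LinearMap.det f ^ 2 * (Matrix.of fun i j ↦ β (b i) (b j)).det := by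
  have h1 : (Matrix.of fun i j ↦ β (f (b i)) (f (b j))) =
      LinearMap.BilinForm.toMatrix b (β.comp f f) := by
    ext i j; simp [LinearMap.BilinForm.toMatrix_apply]
  have h2 : (Matrix.of fun i j ↦ β (b i) (b j)) = LinearMap.BilinForm.toMatrix b β := by
    ext i j; simp [LinearMap.BilinForm.toMatrix_apply]
  rw [h1, h2, LinearMap.BilinForm.toMatrix_comp b b, Matrix.det_mul, Matrix.det_mul,
    Matrix.det_transpose, LinearMap.det_toMatrix]
  ring

/-- The metric at `x`, as a bilinear form on the model space: the tangent space at `x` is identified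
with the model space through the preferred chart at `x`. -/
noncomputable def Metric.modelForm (g : Metric q p M) (x : M) :
    LinearMap.BilinForm ℝ (EuclideanSpace ℝ (Fin (q + p))) :=
  (g.val x).toBilinForm

/-- The determinant of the metric at `x` in the preferred chart at `x`. -/
noncomputable def Metric.modelDet (g : Metric q p M) (x : M) : ℝ :=
  (Matrix.of fun i j ↦ g.modelForm x (EuclideanSpace.basisFun (Fin (q + p)) ℝ i)
    (EuclideanSpace.basisFun (Fin (q + p)) ℝ j)).det

/-- The derivative at `y` of the inverse of the chart at `c`, as an endomorphism of the model
space. -/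
noncomputable def chartDeriv (c : M) (y : EuclideanSpace ℝ (Fin (q + p))) :
    EuclideanSpace ℝ (Fin (q + p)) →ₗ[ℝ] EuclideanSpace ℝ (Fin (q + p)) :=
  (mfderiv (𝓡 (q + p)) (𝓡 (q + p)) (chartAt (EuclideanSpace ℝ (Fin (q + p))) c).symm
    y).toLinearMap

lemma Metric.modelDet_ne_zero (g : Metric q p M) (x : M) : g.modelDet x ≠ 0 := by
  obtain ⟨b, hb⟩ := g.signature x
  have h1 : (LinearMap.BilinForm.toMatrix b (g.val x).toBilinForm).det ≠ 0 := by
    have : LinearMap.BilinForm.toMatrix b (g.val x).toBilinForm =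
        Matrix.diagonal (Sum.elim (fun _ ↦ -1) (fun _ ↦ 1)) := by
      ext i j
      rw [LinearMap.BilinForm.toMatrix_apply, Matrix.diagonal_apply]
      exact hb i j
    rw [this, Matrix.det_diagonal, Fintype.prod_sum_type]
    simp
  have h : (g.modelForm x).Nondegenerate :=
    (LinearMap.BilinForm.nondegenerate_iff_det_ne_zero b).2 h1
  have h2 := (LinearMap.BilinForm.nondegenerate_iff_det_ne_zero
    (EuclideanSpace.basisFun (Fin (q + p)) ℝ).toBasis).1 h
  have h3 : LinearMap.BilinForm.toMatrix (EuclideanSpace.basisFun (Fin (q + p)) ℝ).toBasis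
      (g.modelForm x) = Matrix.of fun i j ↦ g.modelForm x
        (EuclideanSpace.basisFun (Fin (q + p)) ℝ i) (EuclideanSpace.basisFun (Fin (q + p)) ℝ j) := by
    ext i j
    simp [LinearMap.BilinForm.toMatrix_apply]
  rwa [h3] at h2

/-- The density of a chart is the absolute Jacobian of the transition to the preferred charts, times
a function of the point alone. -/
lemma Metric.density_eq (g : Metric q p M) (c : M) (y : EuclideanSpace ℝ (Fin (q + p))) :
    g.density c y = |LinearMap.det (chartDeriv c y)| *
      √|g.modelDet ((chartAt (EuclideanSpace ℝ (Fin (q + p))) c).symm y)| := by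
  have h := det_bilinForm_comp (EuclideanSpace.basisFun (Fin (q + p)) ℝ).toBasis
    (g.modelForm ((chartAt (EuclideanSpace ℝ (Fin (q + p))) c).symm y)) (chartDeriv c y)
  simp only [OrthonormalBasis.coe_toBasis] at h
  have h2 : g.density c y = √|(Matrix.of fun i j ↦
      g.modelForm ((chartAt (EuclideanSpace ℝ (Fin (q + p))) c).symm y)
        (chartDeriv c y (EuclideanSpace.basisFun (Fin (q + p)) ℝ i))
        (chartDeriv c y (EuclideanSpace.basisFun (Fin (q + p)) ℝ j))).det| := by
    simp only [EuclideanSpace.basisFun_apply]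
    rfl
  rw [h2, h, abs_mul, Real.sqrt_mul (abs_nonneg _), abs_pow, Real.sqrt_sq (abs_nonneg _)]
  rfl

lemma det_chartDeriv_ne_zero {c : M} {y : EuclideanSpace ℝ (Fin (q + p))}
    (hy : y ∈ (chartAt (EuclideanSpace ℝ (Fin (q + p))) c).target) :
    LinearMap.det (chartDeriv c y) ≠ 0 := by
  have h : Function.Bijective (chartDeriv c y) :=
    ((mdifferentiable_chart (I := 𝓡 (q + p)) c).symm).mfderiv_bijective hy
  exact (LinearEquiv.isUnit_det' (LinearEquiv.ofBijective _ h)).ne_zero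

lemma Metric.density_pos (g : Metric q p M) {c : M} {y : EuclideanSpace ℝ (Fin (q + p))}
    (hy : y ∈ (chartAt (EuclideanSpace ℝ (Fin (q + p))) c).target) : 0 < g.density c y := by
  rw [density_eq]
  have h1 := det_chartDeriv_ne_zero hy
  have h2 := g.modelDet_ne_zero ((chartAt (EuclideanSpace ℝ (Fin (q + p))) c).symm y)
  positivity

lemma Metric.continuousOn_density (g : Metric q p M) (c : M) :
    ContinuousOn (g.density c) (chartAt (EuclideanSpace ℝ (Fin (q + p))) c).target := by
  set φ := chartAt (EuclideanSpace ℝ (Fin (q + p))) c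
  have hφ : ContMDiffOn (𝓡 (q + p)) (𝓡 (q + p)) ∞ φ.symm φ.target := contMDiffOn_chart_symm
  have hT := hφ.contMDiffOn_tangentMapWithin (m := ∞) le_rfl φ.open_target.uniqueMDiffOn
  intro y hy
  have hc (i : Fin (q + p)) : ContMDiffAt (𝓡 (q + p)) (𝓡 (q + p)).tangent ∞
      (fun y ↦ (TotalSpace.mk' (EuclideanSpace ℝ (Fin (q + p))) (φ.symm y) (coordVector c y i) :
        TangentBundle (𝓡 (q + p)) M)) y := by
    have hs : ContMDiffAt (𝓡 (q + p)) (𝓡 (q + p)).tangent ∞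
        (fun y ↦ (TotalSpace.mk' (EuclideanSpace ℝ (Fin (q + p))) y
          (EuclideanSpace.single i (1 : ℝ)) :
          TangentBundle (𝓡 (q + p)) (EuclideanSpace ℝ (Fin (q + p))))) y :=
      contMDiffAt_vectorSpace_iff_contDiffAt.2 contDiffAt_const
    have hTy := (hT (TotalSpace.mk' _ y (EuclideanSpace.single i (1 : ℝ))) hy).contMDiffAt
      ((φ.open_target.preimage (FiberBundle.continuous_proj _ _)).mem_nhds hy)
    refine (ContMDiffAt.comp y hTy hs).congr_of_eventuallyEq ?_
    filter_upwards [φ.open_target.mem_nhds hy] with z hz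
    simp only [Function.comp_apply, tangentMapWithin, coordVector,
      mfderivWithin_of_isOpen φ.open_target hz]
    rfl
  have hdet : ContinuousAt (fun y ↦ (Matrix.of fun i j ↦
      g.val (φ.symm y) (coordVector c y i) (coordVector c y j)).det) y := by
    simp only [Matrix.det_apply, Matrix.of_apply]
    refine tendsto_finsetSum _ fun σ _ ↦ ContinuousAt.const_smul ?_ _
    exact tendsto_finsetProd _ fun i _ ↦ (g.contMDiffAt_apply (hc _) (hc _)).continuousAt
  exact (Real.continuous_sqrt.continuousAt.comp hdet.abs).continuousWithinAt

section Measure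

variable [MeasurableSpace M] [BorelSpace M]

lemma measurableSet_target_inter_preimage (c : M) {A : Set M} (hA : MeasurableSet A) :
    MeasurableSet ((chartAt (EuclideanSpace ℝ (Fin (q + p))) c).target ∩
      (chartAt (EuclideanSpace ℝ (Fin (q + p))) c).symm ⁻¹' A) := by
  set φ := chartAt (EuclideanSpace ℝ (Fin (q + p))) c
  have h : Measurable (φ.target.domRestrict φ.symm) :=
    (continuousOn_iff_continuous_domRestrict.1 φ.continuousOn_symm).measurable
  have := φ.open_target.measurableSet.subtype_image (h hA)
  convert this using 1
  ext y
  simp [Set.domRestrict, and_comm]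

lemma Metric.chartVolume_apply (g : Metric q p M) (c : M) {A : Set M} (hA : MeasurableSet A) :
    g.chartVolume c A = ∫⁻ y in (chartAt (EuclideanSpace ℝ (Fin (q + p))) c).target ∩
      (chartAt (EuclideanSpace ℝ (Fin (q + p))) c).symm ⁻¹' A, ENNReal.ofReal (g.density c y) := by
  set φ := chartAt (EuclideanSpace ℝ (Fin (q + p))) c
  have h : AEMeasurable φ.symm (volume.restrict φ.target) :=
    φ.continuousOn_symm.aemeasurable φ.open_target.measurableSet
  rw [Metric.chartVolume, Measure.map_apply_of_aemeasurable
    (h.mono_ac (withDensity_absolutelyContinuous _ _)) hA, withDensity_apply',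
    Measure.restrict_restrict', Set.inter_comm]
  exact φ.open_target.measurableSet

/-- On the overlap of two charts, the measures of the charts agree: this is the change of variables
formula, since `√|det g|` transforms with the absolute value of the Jacobian determinant. -/
lemma Metric.chartVolume_le (g : Metric q p M) (c c₀ : M) {A : Set M} (hA : MeasurableSet A)
    (hAc : A ⊆ (chartAt (EuclideanSpace ℝ (Fin (q + p))) c₀).source) :
    g.chartVolume c A ≤ g.chartVolume c₀ A := by
  rw [g.chartVolume_apply c hA, g.chartVolume_apply c₀ hA]
  set φ := chartAt (EuclideanSpace ℝ (Fin (q + p))) c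
  set φ₀ := chartAt (EuclideanSpace ℝ (Fin (q + p))) c₀
  let T : EuclideanSpace ℝ (Fin (q + p)) → EuclideanSpace ℝ (Fin (q + p)) := φ ∘ φ₀.symm
  let B := φ₀.target ∩ φ₀.symm ⁻¹' (A ∩ φ.source)
  have hB : MeasurableSet B :=
    measurableSet_target_inter_preimage c₀ (hA.inter φ.open_source.measurableSet)
  have himage : φ.target ∩ φ.symm ⁻¹' A = T '' B := by
    ext z
    constructor
    · rintro ⟨hz, hzA⟩
      have h0 := hAc hzA
      refine ⟨φ₀ (φ.symm z), ⟨φ₀.map_source h0, ?_⟩, ?_⟩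
      · simp only [Set.mem_preimage, φ₀.left_inv h0]
        exact ⟨hzA, φ.map_target hz⟩
      · simp [T, φ₀.left_inv h0, φ.right_inv hz]
    · rintro ⟨y, ⟨hy, hyA, hyc⟩, rfl⟩
      refine ⟨φ.map_source hyc, ?_⟩
      simp only [T, Set.mem_preimage, Function.comp_apply, φ.left_inv hyc]
      exact hyA
  have hinj : Set.InjOn T B := by
    rintro y ⟨hy, -, hyc⟩ z ⟨hz, -, hzc⟩ h
    exact φ₀.symm.injOn hy hz (φ.injOn hyc hzc h)
  have hTd {y} (hy : y ∈ B) : MDifferentiableAt (𝓡 (q + p)) (𝓡 (q + p)) T y :=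
    ((mdifferentiable_chart (I := 𝓡 (q + p)) c).mdifferentiableAt hy.2.2).comp y
      ((mdifferentiable_chart (I := 𝓡 (q + p)) c₀).mdifferentiableAt_symm hy.1)
  have hderiv {y} (hy : y ∈ B) :
      chartDeriv c₀ y = chartDeriv c (T y) ∘ₗ (fderiv ℝ T y).toLinearMap := by
    have hmem : φ₀.symm ⁻¹' φ.source ∈ 𝓝 y :=
      (φ₀.continuousAt_symm hy.1) (φ.open_source.mem_nhds hy.2.2)
    have h1 : φ₀.symm =ᶠ[𝓝 y] φ.symm ∘ T := by
      filter_upwards [hmem] with z hz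
      simp [T, φ.left_inv hz]
    have h2 := mfderiv_comp y (I := 𝓡 (q + p)) (I' := 𝓡 (q + p)) (I'' := 𝓡 (q + p))
      ((mdifferentiable_chart (I := 𝓡 (q + p)) c).mdifferentiableAt_symm
        (φ.map_source hy.2.2)) (hTd hy)
    rw [mfderiv_eq_fderiv] at h2
    have h3 := h1.mfderiv_eq (I := 𝓡 (q + p)) (I' := 𝓡 (q + p))
    ext v : 1
    exact (DFunLike.congr_fun h3 v).trans (DFunLike.congr_fun h2 v)
  rw [himage, lintegral_image_eq_lintegral_abs_det_fderiv_mul volume hB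
    (fun y hy ↦ (mdifferentiableAt_iff_differentiableAt.1
      (hTd hy)).hasFDerivAt.hasFDerivWithinAt) hinj]
  calc ∫⁻ y in B, ENNReal.ofReal |(fderiv ℝ T y).det| * ENNReal.ofReal (g.density c (T y))
      = ∫⁻ y in B, ENNReal.ofReal (g.density c₀ y) := by
        refine setLIntegral_congr_fun hB fun y hy ↦ ?_
        rw [← ENNReal.ofReal_mul (abs_nonneg _), g.density_eq, g.density_eq, hderiv hy,
          LinearMap.det_comp, abs_mul]
        have h4 : φ.symm (T y) = φ₀.symm y := φ.left_inv hy.2.2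
        rw [show (chartAt (EuclideanSpace ℝ (Fin (q + p))) c).symm (T y) = φ₀.symm y from h4]
        congr 1
        change |LinearMap.det (fderiv ℝ T y).toLinearMap| * _ = _
        ring
    _ ≤ _ := lintegral_mono_set (Set.inter_subset_inter_right _
        (Set.preimage_mono Set.inter_subset_left))

/-- On the domain of a chart, the volume measure is the measure of that chart. -/
lemma Metric.vol_apply (g : Metric q p M) (c : M) {A : Set M} (hA : MeasurableSet A)
    (hAc : A ⊆ (chartAt (EuclideanSpace ℝ (Fin (q + p))) c).source) :
    g.vol A = g.chartVolume c A := by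
  refine le_antisymm ?_ (le_iSup g.chartVolume c A)
  set U := (chartAt (EuclideanSpace ℝ (Fin (q + p))) c).source
  have hU : MeasurableSet U :=
    (chartAt (EuclideanSpace ℝ (Fin (q + p))) c).open_source.measurableSet
  -- `ν` agrees with the measure of the chart at `c` on the domain `U` of that chart, and is
  -- infinite off `U`, so that it dominates the measures of all charts.
  let ν : Measure M := (g.chartVolume c).restrict U + (⊤ : Measure M).restrict Uᶜ
  have hν : g.vol ≤ ν := by
    refine iSup_le fun c' ↦ ?_
    rw [← Measure.restrict_add_restrict_compl (μ := g.chartVolume c') hU]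
    refine add_le_add ?_ (Measure.restrict_mono le_rfl le_top)
    refine Measure.le_iff.2 fun B hB ↦ ?_
    rw [Measure.restrict_apply hB, Measure.restrict_apply hB]
    exact g.chartVolume_le c' c (hB.inter hU) Set.inter_subset_right
  refine (hν A).trans ?_
  have h0 : A ∩ Uᶜ = ∅ := by
    rw [← Set.sdiff_eq, Set.sdiff_eq_empty]
    exact hAc
  rw [Measure.add_apply, Measure.restrict_apply hA, Measure.restrict_apply hA, h0, measure_empty,
    add_zero]
  exact measure_mono Set.inter_subset_left

instance Metric.isLocallyFiniteMeasure_vol (g : Metric q p M) :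
    IsLocallyFiniteMeasure g.vol := by
  refine ⟨fun x ↦ ?_⟩
  set φ := chartAt (EuclideanSpace ℝ (Fin (q + p))) x
  have hx : x ∈ φ.source := mem_chart_source _ x
  obtain ⟨r, hr, hball⟩ := Metric.nhds_basis_closedBall.mem_iff.1
    (φ.open_target.mem_nhds (φ.map_source hx))
  let W := φ.source ∩ φ ⁻¹' (Metric.ball (φ x) r)
  have hW : IsOpen W := φ.isOpen_inter_preimage Metric.isOpen_ball
  refine ⟨W, hW.mem_nhds ⟨hx, Metric.mem_ball_self hr⟩, ?_⟩
  rw [g.vol_apply x hW.measurableSet Set.inter_subset_left,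
    g.chartVolume_apply x hW.measurableSet]
  have hint := ((g.continuousOn_density x).mono hball).integrableOn_compact
    (μ := volume) (isCompact_closedBall _ _)
  refine (lintegral_mono_set ?_).trans_lt hint.lintegral_lt_top
  rintro y ⟨hy, hyW⟩
  have h2 := hyW.2
  rw [Set.mem_preimage, φ.right_inv hy] at h2
  exact Metric.ball_subset_closedBall h2

instance Metric.isOpenPosMeasure_vol (g : Metric q p M) : g.vol.IsOpenPosMeasure := by
  refine ⟨fun W hW ⟨x, hxW⟩ h0 ↦ ?_⟩
  set φ := chartAt (EuclideanSpace ℝ (Fin (q + p))) x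
  have hx : x ∈ φ.source := mem_chart_source _ x
  have h1 : g.chartVolume x W = 0 := le_antisymm ((le_iSup g.chartVolume x W).trans h0.le) bot_le
  rw [g.chartVolume_apply x hW.measurableSet] at h1
  set B := φ.target ∩ φ.symm ⁻¹' W
  have hB : IsOpen B := φ.symm.isOpen_inter_preimage hW
  have hBne : B.Nonempty := ⟨φ x, φ.map_source hx, by simpa [φ.left_inv hx] using hxW⟩
  have hm : AEMeasurable (fun y ↦ ENNReal.ofReal (g.density x y)) (volume.restrict B) :=
    (((g.continuousOn_density x).mono Set.inter_subset_left).aemeasurable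
      hB.measurableSet).ennreal_ofReal
  rw [lintegral_eq_zero_iff' hm] at h1
  have h2 : ∀ᵐ y ∂(volume.restrict B), False := by
    filter_upwards [h1, ae_restrict_mem hB.measurableSet] with y hy hyB
    have := g.density_pos hyB.1
    simp [this.not_ge] at hy
  have h3 : volume B = 0 := by
    rw [← Measure.restrict_eq_zero, ← ae_eq_bot]
    exact Filter.eventually_false_iff_eq_bot.1 h2
  exact (hB.measure_pos volume hBne).ne' h3

end Measure

end Volume

/-! ### Completion of a space with an isometric involution -/

/-- The completion of a (possibly degenerate) inner product space with a self-adjoint involution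
`E`, which extends to the completion. -/
lemma exists_completion_involution {V : Type u} [AddCommGroup V] [Module ℂ V]
    (core : PreInnerProductSpace.Core ℂ V) (E : V →ₗ[ℂ] V) (hE : ∀ v, E (E v) = v)
    (hsymm : ∀ v w, core.inner (E v) w = core.inner v (E w)) :
    ∃ (K : Type u) (_ : NormedAddCommGroup K) (_ : InnerProductSpace ℂ K) (_ : CompleteSpace K)
      (ι : V →ₗ[ℂ] K) (J : K →ₗ[ℂ] K), DenseRange ι ∧
      (∀ v w, inner ℂ (ι v) (ι w) = core.inner v w) ∧ (∀ v, J (ι v) = ι (E v)) ∧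
      (∀ x, J (J x) = x) ∧ ∀ x y, inner ℂ (J x) y = inner ℂ x (J y) := by
  let _ : SeminormedAddCommGroup V := InnerProductSpace.Core.toSeminormedAddCommGroup (𝕜 := ℂ)
    (c := core)
  let _ : InnerProductSpace ℂ V := InnerProductSpace.ofCore core
  have hinner (v w : V) : inner ℂ v w = core.inner v w := rfl
  have hnorm (v : V) : ‖E v‖ = ‖v‖ := by
    rw [norm_eq_sqrt_re_inner (𝕜 := ℂ), norm_eq_sqrt_re_inner (𝕜 := ℂ), hinner, hsymm, hE, hinner]
  let Ec : V →L[ℂ] V := LinearIsometry.toContinuousLinearMap ⟨E, hnorm⟩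
  let J := Ec.completion
  have hJ (v : V) : J (v : UniformSpace.Completion V) = (E v : V) :=
    ContinuousLinearMap.completion_apply_coe Ec v
  refine ⟨UniformSpace.Completion V, inferInstance, inferInstance, inferInstance,
    (UniformSpace.Completion.toComplL (𝕜 := ℂ) (E := V)).toLinearMap, J.toLinearMap,
    UniformSpace.Completion.denseRange_coe, fun v w ↦ UniformSpace.Completion.inner_coe v w, hJ,
    fun x ↦ ?_, fun x y ↦ ?_⟩
  · induction x using UniformSpace.Completion.induction_on with
    | hp => exact isClosed_eq (J.continuous.comp J.continuous) continuous_id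
    | ih v =>
      change J (J v) = v
      rw [hJ, hJ, hE]
  · induction x, y using UniformSpace.Completion.induction_on₂ with
    | hp =>
      exact isClosed_eq ((J.continuous.comp continuous_fst).inner continuous_snd)
        (continuous_fst.inner (J.continuous.comp continuous_snd))
    | ih v w =>
      change inner ℂ (J v) (w : UniformSpace.Completion V) =
        inner ℂ (v : UniformSpace.Completion V) (J w)
      rw [hJ, hJ, UniformSpace.Completion.inner_coe, UniformSpace.Completion.inner_coe]
      exact hsymm v w

section Krein

open scoped Topology

variable {q p : ℕ} {M : Type u} [TopologicalSpace M]
  [ChartedSpace (EuclideanSpace ℝ (Fin (q + p))) M] [IsManifold (𝓡 (q + p)) ∞ M]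
  {F : Type*} [NormedAddCommGroup F] [NormedSpace ℂ F]
  {S : M → Type v} [TopologicalSpace (TotalSpace F S)]
  [∀ x, AddCommGroup (S x)] [∀ x, Module ℂ (S x)] [∀ x, TopologicalSpace (S x)]
  [FiberBundle F S] [VectorBundle ℂ F S] [VectorBundle ℝ F S]
  [ContMDiffVectorBundle ∞ F S (𝓡 (q + p))]
  {g : Metric q p M} {cl : CliffordStructure F S g} {spl : Splitting g}
  {H : ∀ x : M, S x →ₗ⋆[ℂ] S x →ₗ[ℂ] ℂ}

/-! ### The inner product on compactly supported spinors -/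

/-- A smooth field of endomorphisms acts on the compactly supported spinors. -/
def SmoothEnd.toLinearMap {A : ∀ x : M, S x →ₗ[ℂ] S x} (hA : SmoothEnd q p F A) :
    CompactSpinors q p F S →ₗ[ℂ] CompactSpinors q p F S where
  toFun ψ := ⟨fun x ↦ A x (ψ.1 x), fun x₀ ↦ hA x₀ _ (ψ.2.1 x₀),
    ψ.2.2.of_isClosed_subset isClosed_closure
      (closure_mono fun x hx h0 ↦ hx (by simp only [h0, map_zero]))⟩
  map_add' ψ φ := by
    ext x
    exact map_add (A x) _ _
  map_smul' c ψ := by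
    ext x
    exact map_smul (A x) _ _

lemma IsRobinsonProduct.continuous_apply (hH : IsRobinsonProduct cl H)
    (ψ φ : CompactSpinors q p F S) : Continuous fun x ↦ H x (ψ.1 x) (φ.1 x) :=
  continuous_iff_continuousAt.2 fun x ↦
    (hH.smooth x ψ.1 φ.1 (ψ.2.1 x) (φ.2.1 x)).continuousAt

lemma hasCompactSupport_of_eq_zero {R : Type*} [Zero R] (ψ : CompactSpinors q p F S) {f : M → R}
    (hf : ∀ x, ψ.1 x = 0 → f x = 0) : HasCompactSupport f :=
  ψ.2.2.of_isClosed_subset isClosed_closure (closure_mono fun x hx h0 ↦ hx (hf x h0))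

variable [MeasurableSpace M] [BorelSpace M]

lemma IsRobinsonProduct.integrable_apply (hH : IsRobinsonProduct cl H)
    (ψ φ : CompactSpinors q p F S) : Integrable (fun x ↦ H x (ψ.1 x) (φ.1 x)) g.vol :=
  (hH.continuous_apply ψ φ).integrable_of_hasCompactSupport
    (hasCompactSupport_of_eq_zero ψ fun x h0 ↦ by simp [h0])

variable [T2Space M] [FiniteDimensional ℂ F]

/-- The fundamental symmetry as an operator on the compactly supported spinors. -/
noncomputable def symmetryOperator (spl : Splitting g) (heven : Even (q + p))
    (hH : IsRobinsonProduct cl H) : CompactSpinors q p F S →ₗ[ℂ] CompactSpinors q p F S :=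
  (smoothEnd_splittingSymmetry (spl := spl) heven hH).toLinearMap

lemma integrable_fibreNorm (heven : Even (q + p)) (hH : IsRobinsonProduct cl H)
    (ψ φ : CompactSpinors q p F S) :
    Integrable (fun x ↦ H x (ψ.1 x) (splittingSymmetry cl spl H x (φ.1 x))) g.vol :=
  hH.integrable_apply ψ (symmetryOperator spl heven hH φ)

lemma fibreNorm_nonneg (heven : Even (q + p)) (hH : IsRobinsonProduct cl H) (x : M) (v : S x) :
    0 ≤ (H x v (splittingSymmetry cl spl H x v)).re := by
  by_cases h0 : v = 0
  · simp [h0]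
  · exact ((isAdapted_splittingSymmetry (spl := spl) heven hH x).pos v h0).le

lemma hilbertProduct_self_re (heven : Even (q + p)) (hH : IsRobinsonProduct cl H)
    (ψ : CompactSpinors q p F S) : (hilbertProduct cl spl H ψ ψ).re =
      ∫ x, (H x (ψ.1 x) (splittingSymmetry cl spl H x (ψ.1 x))).re ∂g.vol :=
  (integral_re (integrable_fibreNorm (spl := spl) heven hH ψ ψ)).symm

lemma hilbertProduct_conj (heven : Even (q + p)) (hH : IsRobinsonProduct cl H)
    (ψ φ : CompactSpinors q p F S) :
    conj (hilbertProduct cl spl H φ ψ) = hilbertProduct cl spl H ψ φ := by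
  rw [hilbertProduct, hilbertProduct, globalProduct, globalProduct, ← integral_conj]
  congr 1
  ext x
  rw [hH.hermitian, (isAdapted_splittingSymmetry (spl := spl) heven hH x).symm]

/-- The positive semidefinite inner product `⟨·, ·⟩_η` on the compactly supported spinors. -/
noncomputable abbrev hilbertCore (spl : Splitting g) (heven : Even (q + p))
    (hH : IsRobinsonProduct cl H) : PreInnerProductSpace.Core ℂ (CompactSpinors q p F S) where
  inner := hilbertProduct cl spl H
  conj_inner_symm ψ φ := hilbertProduct_conj heven hH ψ φ
  re_inner_nonneg ψ := by
    have h := hilbertProduct_self_re (spl := spl) heven hH ψ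
    change 0 ≤ (hilbertProduct cl spl H ψ ψ).re
    rw [h]
    exact integral_nonneg fun x ↦ fibreNorm_nonneg heven hH x _
  add_left ψ φ χ := by
    have h := integral_add (integrable_fibreNorm (spl := spl) heven hH ψ χ)
      (integrable_fibreNorm (spl := spl) heven hH φ χ)
    rw [hilbertProduct, hilbertProduct, hilbertProduct, globalProduct, globalProduct,
      globalProduct, ← h]
    congr 1
    ext x
    simp
  smul_left ψ φ c := by
    rw [hilbertProduct, hilbertProduct, globalProduct, globalProduct, ← integral_const_mul]
    congr 1
    ext x
    simp

theorem exists_spinorKreinSpace (spl : Splitting g) (heven : Even (q + p))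
    (hH : IsRobinsonProduct cl H) :
    ∃ (K : Type (max u v)) (_ : NormedAddCommGroup K) (_ : InnerProductSpace ℂ K) (_ : CompleteSpace K)
      (ι : CompactSpinors q p F S →ₗ[ℂ] K) (B : K →ₗ⋆[ℂ] K →ₗ[ℂ] ℂ),
      IsSpinorKreinSpace cl spl H ι B := by
  have hη (x : M) (v : S x) := splittingSymmetry_splittingSymmetry (spl := spl) heven hH x v
  obtain ⟨K, _, _, _, ι, J, hd, hι, hJι, hJJ, hJs⟩ := exists_completion_involution
    (hilbertCore spl heven hH) (symmetryOperator spl heven hH)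
    (by
      intro ψ
      ext x
      exact hη x _)
    (by
      intro ψ φ
      change hilbertProduct cl spl H _ _ = hilbertProduct cl spl H _ _
      rw [hilbertProduct, hilbertProduct, globalProduct, globalProduct]
      congr 1
      ext x
      exact ((isAdapted_splittingSymmetry (spl := spl) heven hH x).symm _ _).symm)
  -- The form is `⟨·, J ·⟩`, which extends `(ψ, φ)_M = (ψ, η η φ)_M = ⟨ψ, η φ⟩_η`.
  refine ⟨K, _, _, ‹_›, ι, (innerₛₗ ℂ (E := K)).compl₂ J, hd, hι, fun ψ φ ↦ ?_, J,
    isFundamentalSymmetry_of_involution (fun v w ↦ ?_) (LinearMap.ext hJJ) (fun v w ↦ ?_)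
      (fun v hv ↦ ?_), fun v w ↦ ?_⟩ <;>
  simp only [LinearMap.compl₂_apply, innerₛₗ_apply_apply, hJJ]
  · rw [hJι, hι]
    change hilbertProduct cl spl H _ _ = _
    rw [hilbertProduct, globalProduct, globalProduct]
    congr 1
    ext x
    exact congrArg _ (hη x _)
  · rw [inner_conj_symm, hJs]
  · rw [hJs, hJJ]
  · rw [← norm_pos_iff] at hv
    have h2 : (inner ℂ v v : ℂ).re = ‖v‖ ^ 2 := inner_self_eq_norm_sq (𝕜 := ℂ) v
    rw [h2]
    positivity

lemma IsSpinorKreinSpace.norm_eq {K : Type*} [NormedAddCommGroup K] [InnerProductSpace ℂ K]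
    [CompleteSpace K] {ι : CompactSpinors q p F S →ₗ[ℂ] K} {B : K →ₗ⋆[ℂ] K →ₗ[ℂ] ℂ}
    (h : IsSpinorKreinSpace cl spl H ι B) (ψ : CompactSpinors q p F S) :
    ‖ι ψ‖ = hilbertNorm cl spl H ψ := by
  rw [norm_eq_sqrt_re_inner (𝕜 := ℂ), h.inner_eq]
  rfl

/-- A topological isomorphism of the Krein spaces that is the identity on compactly supported
spinors makes the two norms equivalent. -/
lemma normsEquivalent_of_continuousLinearEquiv {H' : ∀ x : M, S x →ₗ⋆[ℂ] S x →ₗ[ℂ] ℂ}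
    {K : Type*} [NormedAddCommGroup K] [InnerProductSpace ℂ K] [CompleteSpace K]
    {K' : Type*} [NormedAddCommGroup K'] [InnerProductSpace ℂ K'] [CompleteSpace K']
    {ι : CompactSpinors q p F S →ₗ[ℂ] K} {B : K →ₗ⋆[ℂ] K →ₗ[ℂ] ℂ}
    {ι' : CompactSpinors q p F S →ₗ[ℂ] K'} {B' : K' →ₗ⋆[ℂ] K' →ₗ[ℂ] ℂ}
    (h : IsSpinorKreinSpace cl spl H ι B) (h' : IsSpinorKreinSpace cl spl H' ι' B')
    (T : K ≃L[ℂ] K') (hT : ∀ ψ, T (ι ψ) = ι' ψ) :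
    NormsEquivalent (hilbertNorm cl spl H) (hilbertNorm cl spl H') := by
  have h1 : 0 < ‖(T.symm : K' →L[ℂ] K)‖ + 1 := by positivity
  refine ⟨(‖(T.symm : K' →L[ℂ] K)‖ + 1)⁻¹, ‖(T : K →L[ℂ] K')‖ + 1, by positivity, by positivity,
    fun ψ ↦ ?_⟩
  rw [← h.norm_eq, ← h'.norm_eq]
  constructor
  · rw [inv_mul_le_iff₀ h1]
    have h2 := (T.symm : K' →L[ℂ] K).le_opNorm (ι' ψ)
    have h3 : T.symm (ι' ψ) = ι ψ := by rw [← hT, T.symm_apply_apply]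
    rw [ContinuousLinearEquiv.coe_coe, h3] at h2
    nlinarith [norm_nonneg (ι' ψ)]
  · have h2 := (T : K →L[ℂ] K').le_opNorm (ι ψ)
    rw [ContinuousLinearEquiv.coe_coe, hT] at h2
    nlinarith [norm_nonneg (ι ψ)]

/-! ### Rescaling the Robinson product -/

lemma IsRobinsonProduct.scale (hH : IsRobinsonProduct cl H) {l : M → ℝ}
    (hl : ContMDiff (𝓡 (q + p)) 𝓘(ℝ, ℝ) ∞ l) (hl0 : ∀ x, l x ≠ 0) :
    IsRobinsonProduct cl (SpinGeom.scale l H) where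
  hermitian x ψ φ := by simp [SpinGeom.scale, hH.hermitian]
  nondegenerate x ψ h := hH.nondegenerate x ψ fun φ ↦ by
    simpa [SpinGeom.scale, hl0 x] using h φ
  selfAdjoint x u ψ φ := by simp [SpinGeom.scale, hH.selfAdjoint]
  smooth x₀ ψ φ hψ hφ := by
    have h := (hl x₀).smul (hH.smooth x₀ ψ φ hψ hφ)
    refine h.congr_of_eventuallyEq (Filter.Eventually.of_forall fun x ↦ ?_)
    simp [SpinGeom.scale]

lemma splittingSymmetry_scale (heven : Even (q + p)) (hH : IsRobinsonProduct cl H) {l : M → ℝ}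
    (hl : ContMDiff (𝓡 (q + p)) 𝓘(ℝ, ℝ) ∞ l) (hl0 : ∀ x, l x ≠ 0) (x : M) :
    splittingSymmetry cl spl (scale l H) x =
      ((SignType.sign (l x) : ℝ) : ℂ) • splittingSymmetry cl spl H x := by
  refine (isAdapted_splittingSymmetry (spl := spl) heven (hH.scale hl hl0) x).unique ?_
  have h := isAdapted_splittingSymmetry (spl := spl) heven hH x
  rcases (hl0 x).lt_or_gt with h0 | h0
  · rw [sign_neg h0]
    refine ⟨?_, fun u hu ↦ ?_, fun u hu ↦ ?_, fun ψ φ ↦ ?_, fun ψ hψ ↦ ?_⟩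
    · simpa using h.mul_self
    · simpa using h.commute u hu
    · simpa using congrArg Neg.neg (h.anticommute u hu)
    · simp [scale, h.symm]
    · have := h.pos ψ hψ
      simp only [scale, LinearMap.smul_apply]
      simp
      nlinarith
  · rw [sign_pos h0]
    refine ⟨?_, fun u hu ↦ ?_, fun u hu ↦ ?_, fun ψ φ ↦ ?_, fun ψ hψ ↦ ?_⟩
    · simpa using h.mul_self
    · simpa using h.commute u hu
    · simpa using h.anticommute u hu
    · simp [scale, h.symm]
    · have := h.pos ψ hψ
      simp only [scale, LinearMap.smul_apply]
      simp
      nlinarith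

lemma hilbertNorm_eq (heven : Even (q + p)) (hH : IsRobinsonProduct cl H)
    (ψ : CompactSpinors q p F S) : hilbertNorm cl spl H ψ =
      √(∫ x, (H x (ψ.1 x) (splittingSymmetry cl spl H x (ψ.1 x))).re ∂g.vol) := by
  rw [hilbertNorm, hilbertProduct_self_re heven hH]

lemma hilbertNorm_scale_eq (heven : Even (q + p)) (hH : IsRobinsonProduct cl H) {l : M → ℝ}
    (hl : ContMDiff (𝓡 (q + p)) 𝓘(ℝ, ℝ) ∞ l) (hl0 : ∀ x, l x ≠ 0)
    (ψ : CompactSpinors q p F S) : hilbertNorm cl spl (scale l H) ψ =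
      √(∫ x, |l x| * (H x (ψ.1 x) (splittingSymmetry cl spl H x (ψ.1 x))).re ∂g.vol) := by
  rw [hilbertNorm_eq heven (hH.scale hl hl0)]
  congr 2
  ext x
  rw [splittingSymmetry_scale heven hH hl hl0]
  simp only [scale, LinearMap.smul_apply, map_smul, smul_eq_mul, Complex.re_ofReal_mul]
  rw [← mul_assoc, sign_mul_self]

lemma continuous_fibreNorm (heven : Even (q + p)) (hH : IsRobinsonProduct cl H)
    (ψ : CompactSpinors q p F S) :
    Continuous fun x ↦ (H x (ψ.1 x) (splittingSymmetry cl spl H x (ψ.1 x))).re :=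
  Complex.continuous_re.comp (hH.continuous_apply ψ (symmetryOperator spl heven hH ψ))

lemma integrable_mul_fibreNorm (heven : Even (q + p)) (hH : IsRobinsonProduct cl H)
    {k : M → ℝ} (hk : Continuous k) (ψ : CompactSpinors q p F S) :
    Integrable (fun x ↦ k x * (H x (ψ.1 x) (splittingSymmetry cl spl H x (ψ.1 x))).re) g.vol :=
  (hk.mul (continuous_fibreNorm heven hH ψ)).integrable_of_hasCompactSupport
    (hasCompactSupport_of_eq_zero ψ fun x h0 ↦ by simp [h0])

/-- A continuous weight is nonnegative if it is nonnegative in the mean against the densities of all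
compactly supported spinors. -/
lemma nonneg_of_integral_nonneg (heven : Even (q + p)) (hH : IsRobinsonProduct cl H)
    {k : M → ℝ} (hk : Continuous k)
    (h : ∀ ψ : CompactSpinors q p F S,
      0 ≤ ∫ x, k x * (H x (ψ.1 x) (splittingSymmetry cl spl H x (ψ.1 x))).re ∂g.vol)
    (x : M) : 0 ≤ k x := by
  by_contra! hx
  have := cl.nontrivial_fibre x
  obtain ⟨v, hv⟩ := exists_ne (0 : S x)
  obtain ⟨ψ, hψ, hψv, hψ0⟩ := exists_compactSpinor (q := q) (p := p) (F := F)
    ((isOpen_lt hk continuous_const).mem_nhds hx) v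
  have hpos : 0 < ∫ y, -(k y * (H y (ψ y) (splittingSymmetry cl spl H y (ψ y))).re) ∂g.vol := by
    refine Continuous.integral_pos_of_hasCompactSupport_nonneg_nonzero (x := x)
      (hk.mul (continuous_fibreNorm heven hH ⟨ψ, hψ⟩)).neg
      (hasCompactSupport_of_eq_zero ⟨ψ, hψ⟩ fun x h0 ↦ ?_) (fun y ↦ ?_) ?_
    · change ψ x = 0 at h0
      simp [h0]
    · by_cases hy : k y < 0
      · have := fibreNorm_nonneg (spl := spl) heven hH y (ψ y)
        simp only [Pi.zero_apply]
        nlinarith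
      · simp [hψ0 y hy]
    · have := (isAdapted_splittingSymmetry (spl := spl) heven hH x).pos (ψ x) (hψv ▸ hv)
      exact neg_ne_zero.2 (mul_ne_zero hx.ne this.ne')
  rw [integral_neg] at hpos
  have := h ⟨ψ, hψ⟩
  linarith

theorem normsEquivalent_scale_iff (heven : Even (q + p)) (hH : IsRobinsonProduct cl H) {l : M → ℝ}
    (hl : ContMDiff (𝓡 (q + p)) 𝓘(ℝ, ℝ) ∞ l) (hl0 : ∀ x, l x ≠ 0) :
    NormsEquivalent (hilbertNorm cl spl H) (hilbertNorm cl spl (scale l H)) ↔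
      BoundedWithBoundedInverse l := by
  have hint (k : M → ℝ) (hk : Continuous k) (ψ : CompactSpinors q p F S) :=
    integrable_mul_fibreNorm (spl := spl) heven hH hk ψ
  have hnn (x : M) (v : S x) := fibreNorm_nonneg (spl := spl) heven hH x v
  have hlc : Continuous fun x ↦ |l x| := hl.continuous.abs
  constructor
  · rintro ⟨a, b, ha, hb, hab⟩
    simp only [hilbertNorm_eq heven hH, hilbertNorm_scale_eq heven hH hl hl0] at hab
    -- The squares of the two estimates are integrals against the weights `b ^ 2 - |l|` and
    -- `|l| - a ^ 2`.
    have hupper (x : M) : 0 ≤ b ^ 2 - |l x| := by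
      refine nonneg_of_integral_nonneg (spl := spl) heven hH (k := fun x ↦ b ^ 2 - |l x|)
        (continuous_const.sub hlc) (fun ψ ↦ ?_) x
      simp only [sub_mul]
      rw [integral_sub (hint _ continuous_const ψ) (hint _ hlc ψ), integral_const_mul, sub_nonneg]
      have h := (hab ψ).2
      rw [← Real.sqrt_sq hb.le, ← Real.sqrt_mul (sq_nonneg b)] at h
      exact (Real.sqrt_le_sqrt_iff (mul_nonneg (sq_nonneg b)
        (integral_nonneg fun x ↦ hnn x _))).1 h
    have hlower (x : M) : 0 ≤ |l x| - a ^ 2 := by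
      refine nonneg_of_integral_nonneg (spl := spl) heven hH (k := fun x ↦ |l x| - a ^ 2)
        (hlc.sub continuous_const) (fun ψ ↦ ?_) x
      simp only [sub_mul]
      rw [integral_sub (hint _ hlc ψ) (hint _ continuous_const ψ), integral_const_mul, sub_nonneg]
      have h := (hab ψ).1
      rw [← Real.sqrt_sq ha.le, ← Real.sqrt_mul (sq_nonneg a)] at h
      exact (Real.sqrt_le_sqrt_iff
        (integral_nonneg fun x ↦ mul_nonneg (abs_nonneg _) (hnn x _))).1 h
    refine ⟨⟨b ^ 2, fun x ↦ by linarith [hupper x]⟩, (a ^ 2)⁻¹, fun x ↦ ?_⟩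
    rw [abs_inv]
    exact inv_anti₀ (by positivity) (by linarith [hlower x])
  · rintro ⟨⟨C, hC⟩, C', hC'⟩
    have hD : 0 < max C 1 := by positivity
    have hD' : 0 < max C' 1 := by positivity
    refine ⟨(√(max C' 1))⁻¹, √(max C 1), by positivity, by positivity, fun ψ ↦ ?_⟩
    rw [hilbertNorm_eq heven hH, hilbertNorm_scale_eq heven hH hl hl0]
    constructor
    · rw [inv_mul_le_iff₀ (by positivity), ← Real.sqrt_mul hD'.le, ← integral_const_mul]
      refine Real.sqrt_le_sqrt (integral_mono
        (by simpa using hint (fun _ ↦ 1) continuous_const ψ) ((hint _ hlc ψ).const_mul _)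
        fun x ↦ ?_)
      have h1 : 1 ≤ max C' 1 * |l x| := by
        have h2 : |l x|⁻¹ ≤ max C' 1 := by
          rw [← abs_inv]
          exact (hC' x).trans (le_max_left _ _)
        rwa [inv_le_iff_one_le_mul₀ (abs_pos.2 (hl0 x))] at h2
      simp only [← mul_assoc]
      exact le_mul_of_one_le_left (hnn x _) h1
    · rw [← Real.sqrt_mul hD.le, ← integral_const_mul]
      refine Real.sqrt_le_sqrt (integral_mono (hint _ hlc ψ) (hint _ continuous_const ψ) fun x ↦ ?_)
      exact mul_le_mul_of_nonneg_right ((hC x).trans (le_max_left _ _)) (hnn x _)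

end Krein

/-! ### Unbounded functions on noncompact manifolds -/

lemma exists_smooth_pos_unbounded {E : Type*} [NormedAddCommGroup E] [NormedSpace ℝ E]
    [FiniteDimensional ℝ E] {M : Type*} [TopologicalSpace M] [T2Space M]
    [SecondCountableTopology M] [ChartedSpace E M] [IsManifold 𝓘(ℝ, E) ∞ M] [NoncompactSpace M] :
    ∃ l : M → ℝ, ContMDiff 𝓘(ℝ, E) 𝓘(ℝ, ℝ) ∞ l ∧ (∀ x, 0 < l x) ∧ ¬ ∃ C, ∀ x, |l x| ≤ C := by
  have : LocallyCompactSpace M := ChartedSpace.locallyCompactSpace E M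
  let K : CompactExhaustion M := default
  -- The sublevel sets of a function above `K.find` lie in the members of the exhaustion `K`.
  obtain ⟨l, hl⟩ := exists_contMDiffMap_forall_mem_convex_of_local_const (n := ⊤)
    𝓘(ℝ, E) (t := fun x : M ↦ Set.Ici ((K.find x : ℝ) + 1)) (fun x ↦ convex_Ici _) fun x ↦ by
      obtain ⟨n, hn⟩ := K.exists_mem_nhds x
      refine ⟨n + 1, ?_⟩
      filter_upwards [hn] with y hy
      have : K.find y ≤ n := K.mem_iff_find_le.1 hy
      simpa using this
  have hl' (x : M) : (K.find x : ℝ) + 1 ≤ l x := hl x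
  refine ⟨l, l.contMDiff, fun x ↦ by linarith [hl' x, (Nat.cast_nonneg (K.find x) : (0 : ℝ) ≤ _)],
    fun ⟨C, hC⟩ ↦ ?_⟩
  obtain ⟨n, hn⟩ := exists_nat_ge C
  refine noncompact_univ M ((K.isCompact n).of_isClosed_subset isClosed_univ fun x _ ↦ ?_)
  rw [K.mem_iff_find_le]
  have h1 : (K.find x : ℝ) ≤ n := by linarith [hl' x, (le_abs_self (l x)).trans (hC x)]
  exact_mod_cast h1

end SpinGeom

theorem mainTheorem7 {q p : ℕ} (hpos : 0 < q + p) (heven : Even (q + p))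
    {M : Type u} [TopologicalSpace M] [T2Space M] [SecondCountableTopology M]
    [ChartedSpace (EuclideanSpace ℝ (Fin (q + p))) M] [IsManifold (𝓡 (q + p)) ∞ M]
    [MeasurableSpace M] [BorelSpace M]
    {F : Type w₀} [NormedAddCommGroup F] [NormedSpace ℂ F] [FiniteDimensional ℂ F]
    {S : M → Type v} [TopologicalSpace (TotalSpace F S)]
    [∀ x, AddCommGroup (S x)] [∀ x, Module ℂ (S x)] [∀ x, TopologicalSpace (S x)]
    [FiberBundle F S] [VectorBundle ℂ F S] [VectorBundle ℝ F S]
    [ContMDiffVectorBundle ∞ F S (𝓡 (q + p))]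
    (g : SpinGeom.Metric q p M) (cl : SpinGeom.CliffordStructure F S g)
    (spl : SpinGeom.Splitting g) (H : ∀ x : M, S x →ₗ⋆[ℂ] S x →ₗ[ℂ] ℂ)
    (hH : SpinGeom.IsRobinsonProduct cl H) :
    -- the induced inner product and its Krein space are well defined
    ((∃! η, SpinGeom.IsSplittingSymmetry cl spl H η) ∧
      SpinGeom.SmoothEnd q p F (SpinGeom.splittingSymmetry cl spl H) ∧
      ∃ (K : Type (max u v)) (_ : NormedAddCommGroup K) (_ : InnerProductSpace ℂ K)
        (_ : CompleteSpace K) (ι : SpinGeom.CompactSpinors q p F S →ₗ[ℂ] K)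
        (B : K →ₗ⋆[ℂ] K →ₗ[ℂ] ℂ), SpinGeom.IsSpinorKreinSpace cl spl H ι B) ∧
    -- the norms induced by `H` and `λ H`
    (∀ l : M → ℝ, ContMDiff (𝓡 (q + p)) 𝓘(ℝ, ℝ) ∞ l → (∀ x, l x ≠ 0) →
      SpinGeom.IsRobinsonProduct cl (SpinGeom.scale l H) ∧
      (SpinGeom.NormsEquivalent (SpinGeom.hilbertNorm cl spl H)
          (SpinGeom.hilbertNorm cl spl (SpinGeom.scale l H)) ↔
        SpinGeom.BoundedWithBoundedInverse l)) ∧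
    -- the Krein space of a non-compact manifold is not canonical
    (NoncompactSpace M →
      ∃ l : M → ℝ, ContMDiff (𝓡 (q + p)) 𝓘(ℝ, ℝ) ∞ l ∧ (∀ x, l x ≠ 0) ∧
        SpinGeom.IsRobinsonProduct cl (SpinGeom.scale l H) ∧
        ¬ SpinGeom.NormsEquivalent (SpinGeom.hilbertNorm cl spl H)
          (SpinGeom.hilbertNorm cl spl (SpinGeom.scale l H)) ∧
        ∀ (K : Type w₁) [NormedAddCommGroup K] [InnerProductSpace ℂ K] [CompleteSpace K]
          (K' : Type w₂) [NormedAddCommGroup K'] [InnerProductSpace ℂ K'] [CompleteSpace K']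
          (ι : SpinGeom.CompactSpinors q p F S →ₗ[ℂ] K) (B : K →ₗ⋆[ℂ] K →ₗ[ℂ] ℂ)
          (ι' : SpinGeom.CompactSpinors q p F S →ₗ[ℂ] K') (B' : K' →ₗ⋆[ℂ] K' →ₗ[ℂ] ℂ),
          SpinGeom.IsSpinorKreinSpace cl spl H ι B →
          SpinGeom.IsSpinorKreinSpace cl spl (SpinGeom.scale l H) ι' B' →
          ¬ ∃ T : K ≃L[ℂ] K', ∀ ψ, T (ι ψ) = ι' ψ) := by
  refine ⟨⟨SpinGeom.existsUnique_isSplittingSymmetry heven hH,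
    SpinGeom.smoothEnd_splittingSymmetry heven hH, SpinGeom.exists_spinorKreinSpace spl heven hH⟩,
    fun l hl hl0 ↦ ⟨hH.scale hl hl0, SpinGeom.normsEquivalent_scale_iff heven hH hl hl0⟩,
    fun _ ↦ ?_⟩
  obtain ⟨l, hl, hlpos, hunb⟩ :=
    SpinGeom.exists_smooth_pos_unbounded (E := EuclideanSpace ℝ (Fin (q + p))) (M := M)
  have hl0 (x : M) : l x ≠ 0 := (hlpos x).ne'
  have hne : ¬ SpinGeom.NormsEquivalent (SpinGeom.hilbertNorm cl spl H)
      (SpinGeom.hilbertNorm cl spl (SpinGeom.scale l H)) := fun h ↦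
    hunb ((SpinGeom.normsEquivalent_scale_iff heven hH hl hl0).1 h).1
  refine ⟨l, hl, hl0, hH.scale hl hl0, hne, ?_⟩
  rintro K _ _ _ K' _ _ _ ι B ι' B' h h' ⟨T, hT⟩
  exact hne (SpinGeom.normsEquivalent_of_continuousLinearEquiv h h' T hT)
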